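/- All trees are finite. The eccentric sequence of a tree is the nondecreasing sequence of the eccentricities of its vertices, and a sequence of positive integers is a tree eccentric sequence if it is the eccentric sequence of some tree. Let $S$ be a tree eccentric sequence with $n>2$ entries, let $b_1<b_2<\dots<b_l$ be its different entries and let $m_j$ be the number of entries equal to $b_j$. Put $r=b_1$ and $d=b_l$; these are the radius and the diameter of every tree with eccentric sequence $S$, which has order $n$. Let $\mathbf{T}(r;m_2,\ldots,m_l)$ be the tree obtained from the path $v_0,v_1,\ldots,v_{r+l-1}$ by attaching $m_j-2$ pendent edges to the vertex $v_{l+1-j}$ for all $2\le j\le l$. For a connected graph $G$ let $SW_k(G)=\sum_{A\subseteq V(G),\,|A|=k} d_G(A)$, where the Steiner distance $d_G(A)$ is the minimum number of edges in a subtree of $G$ whose vertex set contains $A$. **Theorem.** Let $T$ be a tree with eccentric sequence $S$ and let $k\in\{2,3,\ldots,n-1\}$. Then $$SW_k(T)\ \ge\ SW_k(\mathbf{T}(r;m_2,\ldots,m_l)).$$ If $k\le n-\lceil d/2\rceil$, then equality implies that $T$ is isomorphic to $\mathbf{T}(r;m_2,\ldots,m_l)$. The condition on $k$ is best possible in the following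 sense. Let $n,d,k$ be nonnegative integers with $n\ge d+3$ and $n+1-\lceil d/2\rceil\le k\le n-1$, and let $P_0=v_0,v_1,\ldots,v_d$ be a path. Put $(x,y)=(v_{(d-1)/2},v_{(d+1)/2})$ if $d$ is odd and $(x,y)=(v_{(d-2)/2},v_{(d+2)/2})$ if $d$ is even. Let $T_1$ be obtained from $P_0$ by attaching $n-d-1$ pendent edges to $x$, and let $T_2$ be obtained from $P_0$ by attaching $n-d-2$ pendent edges to $x$ and one pendent edge to $y$. Then $T_1$ and $T_2$ are trees of order $n$ and diameter $d$ with the same eccentric sequence $S$, the tree $T_1$ is isomorphic to the tree $\mathbf{T}(r;m_2,\ldots,m_l)$ belonging to $S$, $SW_k(T_2)=SW_k(\mathbf{T}(r;m_2,\ldots,m_l))$, and $T_2$ is not isomorphic to $\mathbf{T}(r;m_2,\ldots,m_l)$. -/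

import Mathlib

/-- The eccentricity of `v` as a natural number (finite graphs that are connected have finite
eccentricities, so nothing is lost there). -/
noncomputable def vertexEcc {V : Type*} (G : SimpleGraph V) (v : V) : ℕ :=
  (G.eccent v).toNat

/-- The eccentric sequence: the nondecreasing sequence of the eccentricities of the vertices. -/
noncomputable def eccentricSequence {V : Type*} [Fintype V] (G : SimpleGraph V) : List ℕ :=
  ((Finset.univ : Finset V).val.map (vertexEcc G)).sort (· ≤ ·)

/-- A sequence of positive integers that is the eccentric sequence of some (finite) tree. -/
def IsTreeEccentricSequence (S : List ℕ) : Prop :=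
  (∀ a ∈ S, 0 < a) ∧
    ∃ (n : ℕ) (T : SimpleGraph (Fin n)), T.IsTree ∧ eccentricSequence T = S

/-- The number `l` of different entries of `S`. -/
def seqNumValues (S : List ℕ) : ℕ := S.toFinset.card

/-- The different entries `b_1 < b_2 < ⋯ < b_l` of `S`, with the index starting at `1`. -/
def seqValue (S : List ℕ) (j : ℕ) : ℕ := (S.toFinset.sort (· ≤ ·)).getD (j - 1) 0

/-- `m_j` is the number of entries of `S` that are equal to `b_j`, for `1 ≤ j ≤ l`. -/
def seqMult (S : List ℕ) (j : ℕ) : ℕ := S.count (seqValue S j)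

/-- The order `n_S = m_1 + ⋯ + m_l` of the trees that realise `S`. -/
def seqOrder (S : List ℕ) : ℕ := S.length

/-- The radius `r_S = b_1` of the trees that realise `S`. -/
def seqRadius (S : List ℕ) : ℕ := seqValue S 1

/-- The diameter `d_S = b_l` of the trees that realise `S`. -/
def seqDiam (S : List ℕ) : ℕ := seqValue S (seqNumValues S)

/-- Vertices of a path `v_0, …, v_d` with `a i` pendent vertices attached to `v_i`. -/
abbrev PendentPathVertex (d : ℕ) (a : ℕ → ℕ) : Type :=
  Fin (d + 1) ⊕ (Σ i : Fin (d + 1), Fin (a i))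

/-- The tree obtained from the path `v_0, …, v_d` by attaching `a i` pendent edges to `v_i`
for every `i`. -/
def pendentPath (d : ℕ) (a : ℕ → ℕ) : SimpleGraph (PendentPathVertex d a) where
  Adj
    | .inl i, .inl j => (SimpleGraph.pathGraph (d + 1)).Adj i j
    | .inl i, .inr p => p.1 = i
    | .inr p, .inl i => p.1 = i
    | .inr _, .inr _ => False
  symm := ⟨by
    rintro (i | p) (j | q) h
    · exact SimpleGraph.Adj.symm h
    · exact h
    · exact h
    · exact h⟩
  loopless := ⟨by
    rintro (i | p) h
    · exact SimpleGraph.irrefl _ h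
    · exact h⟩

/-- Number of pendent edges attached to `v_i` in `𝐓(b; m_2, …, m_l)`: the vertex `v_{l+1-j}`
receives `m_j - 2` of them, for `2 ≤ j ≤ l`, and no other vertex receives any. -/
def standardPendents (l : ℕ) (m : ℕ → ℕ) (i : ℕ) : ℕ :=
  if 1 ≤ i ∧ i + 1 ≤ l then m (l + 1 - i) - 2 else 0

/-- The tree `𝐓(b; m_2, …, m_l)` (meaningful for `b > 0`, `l ≥ 1` and `m_2, …, m_l > 1`), built on
the path `v_0, …, v_{b+l-1}`. -/
def standardTree (b l : ℕ) (m : ℕ → ℕ) :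
    SimpleGraph (PendentPathVertex (b + l - 1) (standardPendents l m)) :=
  pendentPath (b + l - 1) (standardPendents l m)

/-- The tree `𝐓(r; m_2, …, m_l)` of the sequence `S = (r; m_2, …, m_l)`. -/
abbrev extremalTree (S : List ℕ) := standardTree (seqRadius S) (seqNumValues S) (seqMult S)

/-- The Steiner distance of a set `A` of vertices of a connected graph: the minimum number of
edges of a subtree of `G` whose vertex set contains `A`. -/
noncomputable def steinerDist {V : Type*} (G : SimpleGraph V) (A : Set V) : ℕ :=
  sInf {q : ℕ | ∃ H : G.Subgraph, H.coe.IsTree ∧ A ⊆ H.verts ∧ H.edgeSet.ncard = q}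

/-- The `k`-Steiner Wiener index: the sum of the Steiner distances of all `k`-sets of vertices. -/
noncomputable def steinerWiener {V : Type*} [Fintype V] (k : ℕ) (G : SimpleGraph V) : ℕ :=
  ∑ A ∈ (Finset.univ : Finset V).powersetCard k, steinerDist G (A : Set V)

/-- The path `v_0, …, v_d` with `n - d - 1` pendent edges attached to one vertex: to
`v_{(d-1)/2}` if `d` is odd, and to `v_{(d-2)/2}` if `d` is even. -/
abbrev oneSidedTree (n d : ℕ) :=
  pendentPath d fun i => if i = (d - 1) / 2 then n - d - 1 else 0

/-- The path `v_0, …, v_d` with `n - d - 2` pendent edges attached to `v_{(d-1)/2}` and one to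
`v_{(d+1)/2}` if `d` is odd, and with `n - d - 2` attached to `v_{(d-2)/2}` and one to
`v_{(d+2)/2}` if `d` is even. -/
abbrev twoSidedTree (n d : ℕ) :=
  pendentPath d fun i =>
    if i = (d - 1) / 2 then n - d - 2 else if i = d / 2 + 1 then 1 else 0

/-! An edge of a tree of order n cuts the vertices into parts of sizes s and n - s, and the Steiner
distance of a set is the number of edges that separate two of its elements. Counting pairs of a
k-set and an edge shows that SW_k is (n - 1) * C(n, k) minus the sum over the edges of F(s) = C(s,
k) + C(n - s, k) (`IsRooting.steinerWiener_add`, with F called `unsplitCount`). So SW_k is small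
where the sum of F is large, and F is convex and invariant under s ↦ n - s.

Put D = ⌊d/2⌋ and r = ⌈d/2⌉, and root the tree at a central vertex of a diametral path from x to y.
Above the value r, the eccentricity drops by exactly one from a vertex to its parent. Hence for i <
D the descendant sets of the vertices of eccentricity d - i partition the vertices of eccentricity
at least d - i: the number of these sets and the sum of their sizes depend on S only. The two sets
that contain x and y have at least i + 1 elements each, the others at least one. By convexity the
sum of F over this level is largest for the sizes i + 1, 1, ..., 1 and one set with all the rest. If
d is odd, one more edge joins the two central vertices, with at least r vertices on either side. The
sum of these bounds is `levelBound`, and the standard tree attains all of them at once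
(`edgeSum_eq_levelBound`).

If k + r ≤ n, the convexity inequalities in use are strict. Equality then makes every vertex off the
diametral path a leaf and leaves one half of the path bare (`tight_of_sum_eq`, `isTight`), and the
multiplicities in S determine how many leaves hang at each vertex of the other half
(`nonempty_iso_of_isTight`). For larger k, F vanishes at the edges next to the centre, so a pendent
edge can be moved across the centre at no cost. -/

set_option linter.unusedSectionVars false

/-! ### Convexity of the unsplit count -/

/-- The number of `k`-subsets of an `n`-set that lie on one side of a cut with parts of sizes
`s` and `n - s`. -/
def unsplitCount (n k s : ℕ) : ℕ := s.choose k + (n - s).choose k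

theorem unsplitCount_compl {n s : ℕ} (k : ℕ) (h : s ≤ n) :
    unsplitCount n k (n - s) = unsplitCount n k s := by
  simp only [unsplitCount]
  rw [Nat.sub_sub_self h, add_comm]

theorem unsplitCount_eq_zero {n k s : ℕ} (h1 : s < k) (h2 : n - s < k) :
    unsplitCount n k s = 0 := by
  simp [unsplitCount, Nat.choose_eq_zero_of_lt h1, Nat.choose_eq_zero_of_lt h2]

/-- Convexity of s ↦ C(s, k): by Pascal's rule its increment at s is C(s, k - 1), which is monotone
in s. -/
theorem choose_add_choose_le (k x i j : ℕ) :
    (x + i).choose k + (x + j).choose k ≤ x.choose k + (x + i + j).choose k := by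
  induction j with
  | zero => simp [add_comm]
  | succ j ih =>
    cases k with
    | zero => simp
    | succ k =>
      have h1 : (x + (j + 1)).choose (k + 1) = (x + j).choose k + (x + j).choose (k + 1) :=
        Nat.choose_succ_succ _ _
      have h2 : (x + i + (j + 1)).choose (k + 1) =
        (x + i + j).choose k + (x + i + j).choose (k + 1) := Nat.choose_succ_succ _ _
      have h3 : (x + j).choose k ≤ (x + i + j).choose k := Nat.choose_le_choose _ (by omega)
      omega

theorem choose_lt_choose_of_lt {y z k : ℕ} (hyz : y < z) (hk : 1 ≤ k) (hz : k ≤ z) :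
    y.choose k < z.choose k := by
  obtain ⟨z, rfl⟩ : ∃ z', z = z' + 1 := ⟨z - 1, by omega⟩
  obtain ⟨k, rfl⟩ : ∃ k', k = k' + 1 := ⟨k - 1, by omega⟩
  rw [Nat.choose_succ_succ]
  have h1 : y.choose (k + 1) ≤ z.choose (k + 1) := Nat.choose_le_choose _ (by omega)
  have h2 : 0 < z.choose k := Nat.choose_pos (by omega)
  simp only [Nat.succ_eq_add_one]
  omega

/-- It suffices that the last unit of j gains strictly. Its increment is a binomial coefficient with
lower index k - 1 ≥ 1, hence strictly monotone in the range k ≤ x + i + j. -/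
theorem choose_add_choose_lt {k x i j : ℕ} (hk : 2 ≤ k) (hi : 1 ≤ i) (hj : 1 ≤ j)
    (h : k ≤ x + i + j) :
    (x + i).choose k + (x + j).choose k < x.choose k + (x + i + j).choose k := by
  obtain ⟨j, rfl⟩ : ∃ j', j = j' + 1 := ⟨j - 1, by omega⟩
  obtain ⟨k, rfl⟩ : ∃ k', k = k' + 1 := ⟨k - 1, by omega⟩
  have h1 : (x + (j + 1)).choose (k + 1) = (x + j).choose k + (x + j).choose (k + 1) :=
    Nat.choose_succ_succ _ _
  have h2 : (x + i + (j + 1)).choose (k + 1) =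
    (x + i + j).choose k + (x + i + j).choose (k + 1) := Nat.choose_succ_succ _ _
  have h3 : (x + j).choose k < (x + i + j).choose k :=
    choose_lt_choose_of_lt (by omega) (by omega) (by omega)
  have h4 := choose_add_choose_le (k + 1) x i j
  omega

theorem unsplitCount_add_le (k : ℕ) {n q a b : ℕ} (ha : q ≤ a) (hb : q ≤ b)
    (hn : a + b - q ≤ n) :
    unsplitCount n k a + unsplitCount n k b ≤
      unsplitCount n k q + unsplitCount n k (a + b - q) := by
  obtain ⟨i, rfl⟩ := Nat.exists_eq_add_of_le ha
  obtain ⟨j, rfl⟩ := Nat.exists_eq_add_of_le hb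
  obtain ⟨z, rfl⟩ := Nat.exists_eq_add_of_le hn
  have e : q + i + (q + j) - q = q + i + j := by omega
  simp only [unsplitCount, e]
  have h1 := choose_add_choose_le k q i j
  have h2 := choose_add_choose_le k z i j
  rw [show q + i + j + z - (q + i) = z + j by omega, show q + i + j + z - (q + j) = z + i by omega,
    show q + i + j + z - q = z + i + j by omega, show q + i + j + z - (q + i + j) = z by omega]
  omega

/-- Strictness comes from the summand C(n - s, k) alone. Its largest argument is n - q, so it needs
k + q ≤ n; this is the source of the condition on k in the uniqueness statement. -/
theorem unsplitCount_add_lt {k n q a b : ℕ} (hk : 2 ≤ k) (hkn : k + q ≤ n) (ha : q < a)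
    (hb : q < b) (hn : a + b - q ≤ n) :
    unsplitCount n k a + unsplitCount n k b <
      unsplitCount n k q + unsplitCount n k (a + b - q) := by
  obtain ⟨i, rfl⟩ := Nat.exists_eq_add_of_le ha.le
  obtain ⟨j, rfl⟩ := Nat.exists_eq_add_of_le hb.le
  obtain ⟨z, rfl⟩ := Nat.exists_eq_add_of_le hn
  have e : q + i + (q + j) - q = q + i + j := by omega
  simp only [unsplitCount, e] at hkn ⊢
  have h1 := choose_add_choose_le k q i j
  have h2 := choose_add_choose_lt (x := z) (i := i) (j := j) hk (by omega) (by omega) (by omega)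
  rw [show q + i + j + z - (q + i) = z + j by omega, show q + i + j + z - (q + j) = z + i by omega,
    show q + i + j + z - q = z + i + j by omega, show q + i + j + z - (q + i + j) = z by omega]
  omega

/-- Convexity with q = 1, applied repeatedly: each part shrinks to size 1 and hands its excess `t w`
to the part of size b. -/
theorem unsplitCount_add_sum_le (k : ℕ) {n : ℕ} {ι : Type*} [DecidableEq ι] (K : Finset ι)
    (t : ι → ℕ) {b : ℕ} (hb : 1 ≤ b) (hn : b + ∑ w ∈ K, t w ≤ n) :
    unsplitCount n k b + ∑ w ∈ K, unsplitCount n k (t w + 1) ≤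
      K.card * unsplitCount n k 1 + unsplitCount n k (b + ∑ w ∈ K, t w) := by
  induction K using Finset.induction_on with
  | empty => simp
  | insert a K ha ih =>
    rw [Finset.sum_insert ha] at hn
    rw [Finset.sum_insert ha, Finset.sum_insert ha, Finset.card_insert_of_notMem ha]
    have h1 := ih (by omega)
    have h2 := unsplitCount_add_le k (n := n) (q := 1) (a := b + ∑ w ∈ K, t w) (b := t a + 1)
      (by omega) (by omega) (by omega)
    rw [show b + ∑ w ∈ K, t w + (t a + 1) - 1 = b + (t a + ∑ w ∈ K, t w) by omega] at h2
    rw [add_mul, one_mul]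
    omega

theorem unsplitCount_add_sum_lt {k n : ℕ} (hk : 2 ≤ k) (hkn : k + 1 ≤ n) {ι : Type*}
    [DecidableEq ι] (K : Finset ι) (t : ι → ℕ) {b : ℕ} (hb : 2 ≤ b) (hn : b + ∑ w ∈ K, t w ≤ n)
    (ht : ∃ w ∈ K, 0 < t w) :
    unsplitCount n k b + ∑ w ∈ K, unsplitCount n k (t w + 1) <
      K.card * unsplitCount n k 1 + unsplitCount n k (b + ∑ w ∈ K, t w) := by
  obtain ⟨a, haK, hta⟩ := ht
  rw [← Finset.insert_erase haK] at hn ⊢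
  have ha : a ∉ K.erase a := Finset.notMem_erase a K
  rw [Finset.sum_insert ha] at hn
  rw [Finset.sum_insert ha, Finset.sum_insert ha, Finset.card_insert_of_notMem ha]
  have h1 := unsplitCount_add_sum_le k (n := n) (K.erase a) t (b := b) (by omega) (by omega)
  have h2 := unsplitCount_add_lt (k := k) (n := n) (q := 1) (a := b + ∑ w ∈ K.erase a, t w)
    (b := t a + 1) hk hkn (by omega) (by omega) (by omega)
  rw [show b + ∑ w ∈ K.erase a, t w + (t a + 1) - 1 = b + (t a + ∑ w ∈ K.erase a, t w) by
    omega] at h2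
  rw [add_mul, one_mul]
  omega

theorem sum_pred_add_card {ι : Type*} {s : ι → ℕ} {K : Finset ι} (h : ∀ w ∈ K, 1 ≤ s w) :
    ∑ w ∈ K, (s w - 1) + K.card = ∑ w ∈ K, s w := by
  rw [Finset.card_eq_sum_ones, ← Finset.sum_add_distrib]
  exact Finset.sum_congr rfl fun w hw => Nat.sub_add_cancel (h w hw)

section Level

variable {ι : Type*} [DecidableEq ι] {L : Finset ι} {s : ι → ℕ} {u v : ι} {n q : ℕ}

theorem sum_erase_erase_add {f : ι → ℕ} (hu : u ∈ L) (hv : v ∈ L) (huv : u ≠ v) :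
    ∑ w ∈ L, f w = f u + (f v + ∑ w ∈ (L.erase u).erase v, f w) := by
  rw [← Finset.add_sum_erase L f hu,
    ← Finset.add_sum_erase (L.erase u) f (Finset.mem_erase.2 ⟨huv.symm, hv⟩)]

theorem card_erase_erase (hu : u ∈ L) (hv : v ∈ L) (huv : u ≠ v) :
    ((L.erase u).erase v).card = L.card - 2 := by
  rw [Finset.card_erase_of_mem (Finset.mem_erase.2 ⟨huv.symm, hv⟩), Finset.card_erase_of_mem hu]
  omega

/-- The parts other than u and v shrink to size 1 and pass their excess to v; then u shrinks to q.
The last argument is the size that v has in the end. -/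
theorem sum_unsplitCount_le (k : ℕ) (hu : u ∈ L) (hv : v ∈ L) (huv : u ≠ v) (hq : 1 ≤ q)
    (hsu : q ≤ s u) (hsv : q ≤ s v) (hs : ∀ w ∈ L, 1 ≤ s w) (hn : ∑ w ∈ L, s w ≤ n) :
    ∑ w ∈ L, unsplitCount n k (s w) ≤ unsplitCount n k q + (L.card - 2) * unsplitCount n k 1 +
      unsplitCount n k (∑ w ∈ L, s w - q - (L.card - 2)) := by
  rw [sum_erase_erase_add hu hv huv] at hn
  rw [sum_erase_erase_add hu hv huv, sum_erase_erase_add hu hv huv, ← card_erase_erase hu hv huv]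
  set K := (L.erase u).erase v with hK
  have hsK : ∀ w ∈ K, 1 ≤ s w := fun w hw =>
    hs w (Finset.mem_of_mem_erase (Finset.mem_of_mem_erase hw))
  have e := sum_pred_add_card hsK
  have h1 := unsplitCount_add_sum_le k (n := n) K (fun w => s w - 1) (b := s v) (by omega)
    (by omega)
  have h2 := unsplitCount_add_le k (n := n) (q := q) (a := s u) (b := s v + ∑ w ∈ K, (s w - 1))
    (by omega) (by omega) (by omega)
  have h3 : ∑ w ∈ K, unsplitCount n k (s w - 1 + 1) = ∑ w ∈ K, unsplitCount n k (s w) :=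
    Finset.sum_congr rfl fun w hw => by rw [Nat.sub_add_cancel (hsK w hw)]
  rw [show s u + (s v + ∑ w ∈ K, s w) - q - K.card = s u + (s v + ∑ w ∈ K, (s w - 1)) - q by
    omega]
  omega

/-- Each shrinking step must be free, and convexity is strict. The hypothesis 2 ≤ q is essential:
for q = 1 the large part may be one different from u and v. -/
theorem eq_of_sum_unsplitCount_eq {k : ℕ} (hk : 2 ≤ k) (hkn : k + q ≤ n) (hu : u ∈ L) (hv : v ∈ L)
    (huv : u ≠ v) (hq : 2 ≤ q) (hsu : q ≤ s u) (hsv : q ≤ s v) (hs : ∀ w ∈ L, 1 ≤ s w)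
    (hn : ∑ w ∈ L, s w ≤ n)
    (heq : ∑ w ∈ L, unsplitCount n k (s w) =
      unsplitCount n k q + (L.card - 2) * unsplitCount n k 1 +
        unsplitCount n k (∑ w ∈ L, s w - q - (L.card - 2))) :
    (s u = q ∨ s v = q) ∧ ∀ w ∈ L, w ≠ u → w ≠ v → s w = 1 := by
  rw [sum_erase_erase_add hu hv huv] at hn
  rw [sum_erase_erase_add hu hv huv, sum_erase_erase_add hu hv huv,
    ← card_erase_erase hu hv huv] at heq
  set K := (L.erase u).erase v with hK
  have hsK : ∀ w ∈ K, 1 ≤ s w := fun w hw =>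
    hs w (Finset.mem_of_mem_erase (Finset.mem_of_mem_erase hw))
  have e := sum_pred_add_card hsK
  have h1 := unsplitCount_add_sum_le k (n := n) K (fun w => s w - 1) (b := s v) (by omega)
    (by omega)
  have h2 := unsplitCount_add_le k (n := n) (q := q) (a := s u) (b := s v + ∑ w ∈ K, (s w - 1))
    (by omega) (by omega) (by omega)
  have h3 : ∑ w ∈ K, unsplitCount n k (s w - 1 + 1) = ∑ w ∈ K, unsplitCount n k (s w) :=
    Finset.sum_congr rfl fun w hw => by rw [Nat.sub_add_cancel (hsK w hw)]
  rw [show s u + (s v + ∑ w ∈ K, s w) - q - K.card = s u + (s v + ∑ w ∈ K, (s w - 1)) - q by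
    omega] at heq
  have hK1 : ∀ w ∈ K, s w - 1 = 0 := by
    by_contra! hcon
    obtain ⟨w, hw, hw0⟩ := hcon
    have h4 := unsplitCount_add_sum_lt (k := k) (n := n) hk (by omega) K (fun w => s w - 1)
      (b := s v) (by omega) (by omega) ⟨w, hw, by omega⟩
    omega
  refine ⟨?_, fun w hw hwu hwv => ?_⟩
  · by_contra! hcon
    have h4 := unsplitCount_add_lt (k := k) (n := n) (q := q) (a := s u)
      (b := s v + ∑ w ∈ K, (s w - 1)) hk hkn (by omega) (by omega) (by omega)
    omega
  · have h5 := hK1 w (Finset.mem_erase.2 ⟨hwv, Finset.mem_erase.2 ⟨hwu, hw⟩⟩)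
    have := hs w hw
    omega

end Level

/-! ### Rooted trees -/

/-- `par` is the parent function of `G` with respect to the root `c`, and `rk` is a height function
that increases by one from a parent to its children. -/
structure IsRooting {V : Type*} (G : SimpleGraph V) (c : V) (par : V → V) (rk : V → ℕ) : Prop where
  par_root : par c = c
  rk_par : ∀ v, v ≠ c → rk (par v) + 1 = rk v
  adj_iff : ∀ u v, G.Adj u v ↔ (u ≠ c ∧ par u = v) ∨ (v ≠ c ∧ par v = u)

/-- `w` is a descendant of `v` (or `v` itself) for the parent function `par`. -/
def IsDesc {V : Type*} (par : V → V) (w v : V) : Prop := ∃ i, par^[i] w = v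

open Classical in
/-- The set of descendants of `v`, including `v`. -/
noncomputable def descendants {V : Type*} [Fintype V] (par : V → V) (v : V) : Finset V :=
  Finset.univ.filter fun w => IsDesc par w v

theorem mem_descendants {V : Type*} [Fintype V] {par : V → V} {v w : V} :
    w ∈ descendants par v ↔ IsDesc par w v := by
  simp [descendants]

namespace IsDesc

variable {V : Type*} {par : V → V} {u v w : V}

theorem refl (v : V) : IsDesc par v v := ⟨0, rfl⟩

theorem of_par (h : IsDesc par (par w) v) : IsDesc par w v := by
  obtain ⟨i, hi⟩ := h
  exact ⟨i + 1, hi⟩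

theorem par_of_ne (h : IsDesc par w v) (hne : w ≠ v) : IsDesc par (par w) v := by
  obtain ⟨_ | i, hi⟩ := h
  · exact absurd hi hne
  · exact ⟨i, hi⟩

theorem trans (h1 : IsDesc par u v) (h2 : IsDesc par v w) : IsDesc par u w := by
  obtain ⟨i, rfl⟩ := h1
  obtain ⟨j, rfl⟩ := h2
  exact ⟨j + i, Function.iterate_add_apply _ _ _ _⟩

theorem total (h1 : IsDesc par w u) (h2 : IsDesc par w v) : IsDesc par u v ∨ IsDesc par v u := by
  obtain ⟨i, rfl⟩ := h1
  obtain ⟨j, rfl⟩ := h2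
  rcases le_total i j with h | h
  · exact Or.inl ⟨j - i, by rw [← Function.iterate_add_apply, Nat.sub_add_cancel h]⟩
  · exact Or.inr ⟨i - j, by rw [← Function.iterate_add_apply, Nat.sub_add_cancel h]⟩

end IsDesc

namespace IsRooting

variable {V : Type*} {G : SimpleGraph V} {c : V} {par : V → V} {rk : V → ℕ}

theorem par_ne (h : IsRooting G c par rk) {v : V} (hv : v ≠ c) : par v ≠ v := by
  intro e
  have := h.rk_par v hv
  rw [e] at this
  omega

theorem adj_par (h : IsRooting G c par rk) {v : V} (hv : v ≠ c) : G.Adj v (par v) :=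
  (h.adj_iff _ _).2 (Or.inl ⟨hv, rfl⟩)

theorem isDesc_root (h : IsRooting G c par rk) (v : V) : IsDesc par v c := by
  induction hn : rk v generalizing v with
  | zero =>
    by_cases hv : v = c
    · exact hv ▸ IsDesc.refl _
    · have := h.rk_par v hv
      omega
  | succ n ih =>
    by_cases hv : v = c
    · exact hv ▸ IsDesc.refl _
    · have := h.rk_par v hv
      exact (ih (par v) (by omega)).of_par

theorem isDesc_of_root (h : IsRooting G c par rk) {v : V} (hv : IsDesc par c v) : v = c := by
  obtain ⟨i, rfl⟩ := hv
  exact Function.iterate_fixed h.par_root i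

theorem rk_le (h : IsRooting G c par rk) {w v : V} (hw : IsDesc par w v) : rk v ≤ rk w := by
  obtain ⟨i, rfl⟩ := hw
  induction i generalizing w with
  | zero => rfl
  | succ i ih =>
    refine (ih (w := par w)).trans ?_
    by_cases hwc : w = c
    · rw [hwc, h.par_root]
    · have := h.rk_par w hwc
      omega

theorem rk_lt (h : IsRooting G c par rk) {w v : V} (hw : IsDesc par w v) (hne : w ≠ v) :
    rk v < rk w := by
  have hwc : w ≠ c := by
    rintro rfl
    exact hne (h.isDesc_of_root hw).symm
  have := h.rk_par w hwc
  have := h.rk_le (hw.par_of_ne hne)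
  omega

/-- This makes the parent edge of v a cut. Distances and subtrees are controlled below by locating
the place where a walk leaves the descendants of v. -/
theorem eq_of_adj_of_isDesc (h : IsRooting G c par rk) {u v w : V} (huw : G.Adj u w)
    (hu : IsDesc par u v) (hw : ¬ IsDesc par w v) : u = v ∧ w = par v := by
  rcases (h.adj_iff _ _).1 huw with ⟨-, rfl⟩ | ⟨-, rfl⟩
  · by_cases huv : u = v
    · exact ⟨huv, by rw [huv]⟩
    · exact absurd (hu.par_of_ne huv) hw
  · exact absurd hu.of_par hw

theorem connected (h : IsRooting G c par rk) : G.Connected := by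
  have key : ∀ v, G.Reachable v c := by
    intro v
    obtain ⟨i, hi⟩ := h.isDesc_root v
    induction i generalizing v with
    | zero => exact hi ▸ SimpleGraph.Reachable.refl _
    | succ i ih =>
      by_cases hv : v = c
      · exact hv ▸ SimpleGraph.Reachable.refl _
      · exact (h.adj_par hv).reachable.trans (ih (par v) hi)
  have : Nonempty V := ⟨c⟩
  exact ⟨fun u v => (key u).trans (key v).symm⟩

theorem edge_injOn (h : IsRooting G c par rk) :
    Set.InjOn (fun v => s(v, par v)) {v | v ≠ c} := by
  intro u hu v hv huv
  simp only [Sym2.eq_iff] at huv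
  rcases huv with ⟨e, -⟩ | ⟨e1, e2⟩
  · exact e
  · have h1 := h.rk_par u hu
    have h2 := h.rk_par v hv
    rw [e2] at h1
    rw [← e1] at h2
    omega

theorem edgeSet_eq (h : IsRooting G c par rk) :
    G.edgeSet = (fun v => s(v, par v)) '' {v | v ≠ c} := by
  ext e
  induction e with
  | h u v =>
    simp only [SimpleGraph.mem_edgeSet, h.adj_iff, Set.mem_image, Set.mem_ofPred_eq, Sym2.eq_iff]
    constructor
    · rintro (⟨h1, h2⟩ | ⟨h1, h2⟩)
      · exact ⟨u, h1, Or.inl ⟨rfl, h2⟩⟩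
      · exact ⟨v, h1, Or.inr ⟨rfl, h2⟩⟩
    · rintro ⟨w, hw, ⟨rfl, h2⟩ | ⟨rfl, h2⟩⟩
      · exact Or.inl ⟨hw, h2⟩
      · exact Or.inr ⟨hw, h2⟩

theorem card_edgeSet_add_one [Finite V] (h : IsRooting G c par rk) :
    Nat.card G.edgeSet + 1 = Nat.card V := by
  rw [h.edgeSet_eq, Nat.card_coe_set_eq, h.edge_injOn.ncard_image]
  have := Set.ncard_add_ncard_compl {c}
  rw [Set.ncard_singleton] at this
  rw [← this, add_comm]
  rfl

theorem isTree [Finite V] (h : IsRooting G c par rk) : G.IsTree :=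
  SimpleGraph.isTree_iff_connected_and_card.2 ⟨h.connected, h.card_edgeSet_add_one⟩

theorem dist_le_of_iterate (h : IsRooting G c par rk) (v : V) (i : ℕ) :
    G.dist v (par^[i] v) ≤ i := by
  induction i generalizing v with
  | zero => simp
  | succ i ih =>
    by_cases hv : v = c
    · rw [hv, Function.iterate_fixed h.par_root]
      simp
    · refine h.connected.dist_triangle (v := par v) |>.trans ?_
      rw [SimpleGraph.dist_eq_one_iff_adj.2 (h.adj_par hv), Function.iterate_succ_apply]
      have := ih (par v)
      omega

/-- A shortest walk from y to w leaves the descendants of v, and the only exit leads to `par v`; the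
walk is divided there. -/
theorem dist_eq_of_isDesc (h : IsRooting G c par rk) {v w y : V} (hy : IsDesc par y v)
    (hw : ¬ IsDesc par w v) : G.dist w y = G.dist w (par v) + G.dist (par v) y := by
  classical
  refine le_antisymm h.connected.dist_triangle ?_
  obtain ⟨p, hp⟩ := h.connected.exists_walk_length_eq_dist y w
  obtain ⟨d, hd, hd1, hd2⟩ := p.exists_boundary_dart {z | IsDesc par z v} hy hw
  have e := (h.eq_of_adj_of_isDesc d.adj hd1 hd2).2
  have hs : par v ∈ p.support := e ▸ p.dart_snd_mem_support_of_mem_darts hd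
  have h1 := congrArg SimpleGraph.Walk.length (p.take_spec hs)
  rw [SimpleGraph.Walk.length_append] at h1
  have h2 := SimpleGraph.dist_le (p.takeUntil _ hs)
  have h3 := SimpleGraph.dist_le (p.dropUntil _ hs)
  rw [SimpleGraph.dist_comm (u := w) (v := y), SimpleGraph.dist_comm (u := w),
    SimpleGraph.dist_comm (u := par v) (v := y)]
  omega

end IsRooting

/-- Every tree can be rooted at each of its vertices, with the distance from the root as height. -/
theorem SimpleGraph.IsTree.exists_isRooting {V : Type*} [Finite V] {G : SimpleGraph V}
    (hG : G.IsTree) (c : V) : ∃ par : V → V, IsRooting G c par (G.dist c) := by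
  have hconn := hG.connected
  -- The parent is the second vertex of a shortest walk to c.
  have key : ∀ v, ∃ u, (v = c → u = c) ∧ (v ≠ c → G.Adj v u ∧ G.dist c u + 1 = G.dist c v) := by
    intro v
    by_cases hv : v = c
    · exact ⟨c, fun _ => rfl, fun hne => absurd hv hne⟩
    · obtain ⟨p, hp⟩ := hconn.exists_walk_length_eq_dist v c
      cases p with
      | nil => exact absurd rfl hv
      | cons hadj q =>
        rename_i u
        refine ⟨u, fun e => absurd e hv, fun _ => ⟨hadj, ?_⟩⟩
        rw [SimpleGraph.Walk.length_cons] at hp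
        have h1 := SimpleGraph.dist_le q
        have h2 := hconn.dist_triangle (u := v) (v := u) (w := c)
        rw [SimpleGraph.dist_eq_one_iff_adj.2 hadj] at h2
        rw [SimpleGraph.dist_comm (u := c) (v := u), SimpleGraph.dist_comm (u := c) (v := v)]
        omega
  choose par hpar1 hpar2 using key
  have hinj : Set.InjOn (fun v => s(v, par v)) {v | v ≠ c} := by
    intro u hu v hv huv
    simp only [Sym2.eq_iff] at huv
    rcases huv with ⟨e, -⟩ | ⟨e1, e2⟩
    · exact e
    · have h1 := (hpar2 u hu).2
      have h2 := (hpar2 v hv).2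
      rw [e2] at h1
      rw [← e1] at h2
      omega
  have hsub : (fun v => s(v, par v)) '' {v | v ≠ c} ⊆ G.edgeSet := by
    rintro _ ⟨v, hv, rfl⟩
    exact (hpar2 v hv).1
  -- There are n - 1 different parent edges and a tree has n - 1 edges, so every edge is a parent
  -- edge.
  have heq : (fun v => s(v, par v)) '' {v | v ≠ c} = G.edgeSet := by
    refine Set.eq_of_subset_of_ncard_le hsub ?_ (Set.toFinite _)
    have h1 := (SimpleGraph.isTree_iff_connected_and_card.1 hG).2
    rw [Nat.card_coe_set_eq] at h1
    rw [hinj.ncard_image]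
    have h2 := Set.ncard_add_ncard_compl {c}
    rw [Set.ncard_singleton] at h2
    have h3 : ({c}ᶜ : Set V) = {v | v ≠ c} := rfl
    rw [h3] at h2
    omega
  refine ⟨par, ⟨hpar1 c rfl, fun v hv => (hpar2 v hv).2, fun u v => ⟨fun huv => ?_, ?_⟩⟩⟩
  · have hmem : s(u, v) ∈ (fun v => s(v, par v)) '' {v | v ≠ c} := by
      rw [heq]
      exact huv
    obtain ⟨w, hw, e⟩ := hmem
    rcases Sym2.eq_iff.1 e with ⟨rfl, e2⟩ | ⟨rfl, e2⟩
    · exact Or.inl ⟨hw, e2⟩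
    · exact Or.inr ⟨hw, e2⟩
  · rintro (⟨h1, rfl⟩ | ⟨h1, rfl⟩)
    · exact (hpar2 u h1).1
    · exact (hpar2 v h1).1.symm

/-! ### Steiner distances count separating edges -/

namespace IsRooting

variable {V : Type*} {G : SimpleGraph V} {c : V} {par : V → V} {rk : V → ℕ}

/-- The vertices whose parent edge separates two vertices of `A`. -/
def separators (par : V → V) (A : Set V) : Set V :=
  {v | (∃ w ∈ A, IsDesc par w v) ∧ ∃ w ∈ A, ¬ IsDesc par w v}

theorem ne_root_of_mem_separators (h : IsRooting G c par rk) {A : Set V} {v : V}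
    (hv : v ∈ separators par A) : v ≠ c := by
  rintro rfl
  obtain ⟨-, w, -, hw⟩ := hv
  exact hw (h.isDesc_root w)

/-- A walk inside the subtree between two separated elements of A must use the separating parent
edge. -/
theorem ncard_separators_le [Finite V] (h : IsRooting G c par rk) {A : Set V} {H : G.Subgraph}
    (hH : H.coe.IsTree) (hA : A ⊆ H.verts) : (separators par A).ncard ≤ H.edgeSet.ncard := by
  have hinj : Set.InjOn (fun v => s(v, par v)) (separators par A) :=
    h.edge_injOn.mono fun v hv => h.ne_root_of_mem_separators hv
  rw [← hinj.ncard_image]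
  refine Set.ncard_le_ncard ?_ (Set.toFinite _)
  rintro _ ⟨v, ⟨⟨a, ha, hav⟩, b, hb, hbv⟩, rfl⟩
  obtain ⟨p⟩ := hH.connected.preconnected ⟨a, hA ha⟩ ⟨b, hA hb⟩
  obtain ⟨d, -, hd1, hd2⟩ := p.exists_boundary_dart {z | IsDesc par z.1 v} hav hbv
  have hadj : H.Adj d.fst d.snd := d.adj
  obtain ⟨e1, e2⟩ := h.eq_of_adj_of_isDesc hadj.adj_sub hd1 hd2
  rw [e1, e2] at hadj
  exact hadj

/-- The optimal subtree consists of the paths from the elements of A up to their lowest common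
ancestor t. Apart from t, its vertices are exactly those whose parent edge separates A. -/
theorem exists_subtree [Finite V] (h : IsRooting G c par rk) {A : Set V} (hA : A.Nonempty) :
    ∃ H : G.Subgraph, H.coe.IsTree ∧ A ⊆ H.verts ∧
      H.edgeSet.ncard = (separators par A).ncard := by
  classical
  obtain ⟨t, ht, htmax⟩ := Set.exists_max_image {t | ∀ w ∈ A, IsDesc par w t} rk (Set.toFinite _)
    ⟨c, fun w _ => h.isDesc_root w⟩
  obtain ⟨a, ha⟩ := hA
  set U : Set V := {u | (∃ w ∈ A, IsDesc par w u) ∧ IsDesc par u t} with hU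
  have htU : t ∈ U := ⟨⟨a, ha, ht a ha⟩, IsDesc.refl t⟩
  have hparU : ∀ u ∈ U, u ≠ t → par u ∈ U := by
    rintro u ⟨⟨w, hw, hwu⟩, hut⟩ hne
    exact ⟨⟨w, hw, hwu.trans ⟨1, rfl⟩⟩, hut.par_of_ne hne⟩
  have hc : ∀ u ∈ U, u ≠ t → u ≠ c := by
    rintro u hu hne rfl
    exact hne (h.isDesc_of_root hu.2).symm
  set H : G.Subgraph := (⊤ : G.Subgraph).induce U with hHdef
  set par' : U → U := fun u => if hu : u.1 = t then ⟨t, htU⟩ else ⟨par u, hparU u u.2 hu⟩ with hp'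
  -- The height is inherited from G and need not vanish at the new root t; `IsRooting` only asks for
  -- unit steps.
  have hroot : IsRooting H.coe ⟨t, htU⟩ par' (fun u => rk u.1) := by
    refine ⟨dif_pos rfl, ?_, ?_⟩
    · rintro ⟨v, hv⟩ hne
      have hvt : v ≠ t := fun e => hne (Subtype.ext e)
      simp only [hp', hvt, dite_false]
      exact h.rk_par v (hc v hv hvt)
    · rintro ⟨u, hu⟩ ⟨v, hv⟩
      have hadj : H.coe.Adj ⟨u, hu⟩ ⟨v, hv⟩ ↔ G.Adj u v := by
        simp only [SimpleGraph.Subgraph.coe_adj, hHdef, SimpleGraph.Subgraph.induce_adj,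
          SimpleGraph.Subgraph.top_adj]
        exact ⟨fun e => e.2.2, fun e => ⟨hu, hv, e⟩⟩
      have aux : ∀ x y : U, (x ≠ ⟨t, htU⟩ ∧ par' x = y) ↔ (x.1 ≠ c ∧ par x.1 = y.1) := by
        rintro ⟨x, hx⟩ ⟨y, hy⟩
        by_cases hxt : x = t
        · subst hxt
          simp only [ne_eq, not_true_eq_false, false_and, false_iff, not_and]
          intro hxc hxy
          have h1 := h.rk_par x hxc
          have h2 := h.rk_le hy.2
          rw [← hxy] at h2
          omega
        · simp only [hp', hxt, dite_false, Subtype.mk.injEq, ne_eq, not_false_eq_true, true_and]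
          exact ⟨fun e => ⟨hc x hx hxt, e⟩, fun e => e.2⟩
      rw [hadj, h.adj_iff]
      exact (or_congr (aux ⟨u, hu⟩ ⟨v, hv⟩) (aux ⟨v, hv⟩ ⟨u, hu⟩)).symm
  refine ⟨H, hroot.isTree, fun w hw => ⟨⟨w, hw, IsDesc.refl w⟩, ht w hw⟩, ?_⟩
  have h1 := hroot.card_edgeSet_add_one
  have h2 : H.edgeSet.ncard = Nat.card H.coe.edgeSet := by
    rw [← SimpleGraph.Subgraph.image_coe_edgeSet_coe,
      Set.ncard_image_of_injective _ (Sym2.map.injective Subtype.val_injective)]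
    rfl
  have h3 : separators par A = U \ {t} := by
    ext u
    constructor
    · rintro ⟨⟨w, hw, hwu⟩, b, hb, hbu⟩
      refine ⟨⟨⟨w, hw, hwu⟩, ?_⟩, ?_⟩
      · rcases hwu.total (ht w hw) with e | e
        · exact e
        · exact absurd ((ht b hb).trans e) hbu
      · rintro rfl
        exact hbu (ht b hb)
    · rintro ⟨⟨hw, hut⟩, hne⟩
      refine ⟨hw, ?_⟩
      by_contra! hcon
      have := htmax u hcon
      have := h.rk_lt hut hne
      omega
  have h4 : Nat.card H.verts = U.ncard := rfl
  rw [h3, Set.ncard_sdiff_singleton_of_mem htU]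
  omega

theorem steinerDist_eq [Finite V] (h : IsRooting G c par rk) {A : Set V} (hA : A.Nonempty) :
    steinerDist G A = (separators par A).ncard := by
  refine le_antisymm (Nat.sInf_le (h.exists_subtree hA)) (le_csInf ⟨_, h.exists_subtree hA⟩ ?_)
  rintro _ ⟨H, hH, hAH, rfl⟩
  exact h.ncard_separators_le hH hAH

variable [Fintype V]

open Classical in
-- An unsplit set lies among the descendants or in their complement. Not in both, since k ≥ 1
-- excludes the empty set.
theorem card_not_split (par : V → V) (v : V) {k : ℕ} (hk : 1 ≤ k) :
    (((Finset.univ : Finset V).powersetCard k).filter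
      fun A : Finset V => v ∉ separators par (A : Set V)).card =
      unsplitCount (Fintype.card V) k (descendants par v).card := by
  have : ((Finset.univ : Finset V).powersetCard k).filter
      (fun A : Finset V => v ∉ separators par (A : Set V)) =
      (descendants par v).powersetCard k ∪ ((descendants par v)ᶜ).powersetCard k := by
    ext A
    simp only [Finset.mem_filter, Finset.mem_powersetCard, Finset.mem_union, separators,
      Set.mem_ofPred_eq, Finset.mem_coe, Finset.subset_iff, Finset.mem_compl, mem_descendants]
    constructor
    · rintro ⟨⟨-, hA⟩, h1⟩
      by_cases h2 : ∀ w ∈ A, ¬ IsDesc par w v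
      · exact Or.inr ⟨h2, hA⟩
      · refine Or.inl ⟨fun w hw => ?_, hA⟩
        by_contra h3
        push Not at h2
        exact h1 ⟨h2, w, hw, h3⟩
    · rintro (⟨h1, hA⟩ | ⟨h1, hA⟩)
      · exact ⟨⟨fun w _ => Finset.mem_univ w, hA⟩, fun h => h.2.elim fun w hw => hw.2 (h1 hw.1)⟩
      · exact ⟨⟨fun w _ => Finset.mem_univ w, hA⟩, fun h => h.1.elim fun w hw => h1 hw.1 hw.2⟩
  rw [this, Finset.card_union_of_disjoint, Finset.card_powersetCard, Finset.card_powersetCard,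
    Finset.card_compl]
  · rfl
  · rw [Finset.disjoint_left]
    intro A h1 h2
    rw [Finset.mem_powersetCard] at h1 h2
    obtain ⟨a, ha⟩ := Finset.card_pos.1 (h1.2 ▸ hk : 0 < A.card)
    exact Finset.mem_compl.1 (h2.1 ha) (h1.1 ha)

/-- Double counting of k-sets against parent edges. The additive form avoids truncated subtraction.
-/
theorem steinerWiener_add (h : IsRooting G c par rk) {k : ℕ} (hk : 1 ≤ k) [DecidableEq V] :
    steinerWiener k G + ∑ v ∈ Finset.univ.erase c,
      unsplitCount (Fintype.card V) k (descendants par v).card =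
      (Fintype.card V - 1) * (Fintype.card V).choose k := by
  classical
  have h1 : ∀ A ∈ (Finset.univ : Finset V).powersetCard k, steinerDist G (A : Set V) =
      ((Finset.univ.erase c).filter fun v => v ∈ separators par (A : Set V)).card := by
    intro A hA
    have hAne : A.Nonempty := Finset.card_pos.1 ((Finset.mem_powersetCard.1 hA).2 ▸ hk)
    rw [h.steinerDist_eq (Finset.coe_nonempty.2 hAne), ← Set.ncard_coe_finset]
    congr 1
    ext v
    simp only [Finset.coe_filter, Finset.mem_erase, Finset.mem_univ, and_true, Set.mem_ofPred_eq]
    exact ⟨fun hv => ⟨h.ne_root_of_mem_separators hv, hv⟩, fun hv => hv.2⟩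
  rw [steinerWiener, Finset.sum_congr rfl h1]
  have h2 : ∑ A ∈ (Finset.univ : Finset V).powersetCard k,
      ((Finset.univ.erase c).filter fun v => v ∈ separators par (A : Set V)).card =
      ∑ v ∈ Finset.univ.erase c, (((Finset.univ : Finset V).powersetCard k).filter
        fun A : Finset V => v ∈ separators par (A : Set V)).card := by
    simp only [Finset.card_filter]
    exact Finset.sum_comm
  rw [h2, ← Finset.sum_add_distrib]
  have h3 : ∀ v ∈ Finset.univ.erase c, (((Finset.univ : Finset V).powersetCard k).filter
        fun A : Finset V => v ∈ separators par (A : Set V)).card +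
        unsplitCount (Fintype.card V) k (descendants par v).card =
        (Fintype.card V).choose k := by
    intro v _
    rw [← card_not_split par v hk, Finset.card_filter_add_card_filter_not,
      Finset.card_powersetCard, Finset.card_univ]
  rw [Finset.sum_congr rfl h3, Finset.sum_const, Finset.card_erase_of_mem (Finset.mem_univ c),
    Finset.card_univ, smul_eq_mul]

end IsRooting

/-! ### Eccentricities seen from the centre -/

theorem vertexEcc_eq {V : Type*} [Finite V] {G : SimpleGraph V} (hG : G.Connected) {v u : V} {m : ℕ}
    (hle : ∀ w, G.dist v w ≤ m) (hu : G.dist v u = m) : vertexEcc G v = m := by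
  have h : G.eccent v = m := by
    refine le_antisymm ((SimpleGraph.eccent_le_iff v m).2 fun w => ?_) ?_
    · rw [← (hG v w).coe_dist_eq_edist]
      exact_mod_cast hle w
    · rw [← hu, (hG v u).coe_dist_eq_edist]
      exact SimpleGraph.edist_le_eccent
  simp [vertexEcc, h]

theorem SimpleGraph.Connected.exists_dist_eq {V : Type*} {G : SimpleGraph V} (hG : G.Connected)
    {x y : V} {a b : ℕ} (h : G.dist x y = a + b) : ∃ c, G.dist c x = a ∧ G.dist c y = b := by
  obtain ⟨p, hp⟩ := hG.exists_walk_length_eq_dist x y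
  have h1 := SimpleGraph.dist_le (p.take a)
  have h2 := SimpleGraph.dist_le (p.drop a)
  rw [SimpleGraph.Walk.take_length] at h1
  rw [SimpleGraph.Walk.drop_length] at h2
  have h3 := hG.dist_triangle (u := x) (v := p.getVert a) (w := y)
  refine ⟨p.getVert a, ?_, ?_⟩
  · rw [SimpleGraph.dist_comm]
    omega
  · omega

/-- A rooting at a vertex `c` of minimum eccentricity: the child `c'` of `c` separates the
diametral vertices `x` and `y`, at distances `D` and `r` from `c`, where `D ≤ r ≤ D + 1`. -/
structure IsCentralRooting {V : Type*} (G : SimpleGraph V) (c c' x y : V) (par : V → V)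
    (D r : ℕ) : Prop where
  rooting : IsRooting G c par (G.dist c)
  ne : c' ≠ c
  par_child : par c' = c
  D_le : D ≤ r
  r_le : r ≤ D + 1
  not_desc_x : ¬ IsDesc par x c'
  desc_y : IsDesc par y c'
  dist_x : G.dist c x = D
  dist_y : G.dist c y = r
  le_D : ∀ w, ¬ IsDesc par w c' → G.dist c w ≤ D
  le_r : ∀ w, IsDesc par w c' → G.dist c w ≤ r

/-- The root c divides a shortest walk from x to y at distance D from x, and c' is the last vertex
before c on the way up from y. The height bounds follow by comparing w with y or x across the edge
between c' and c. -/
theorem SimpleGraph.IsTree.exists_isCentralRooting {V : Type*} [Finite V] {G : SimpleGraph V}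
    (hG : G.IsTree) {x y : V} {D r : ℕ} (hr : 1 ≤ r) (hD : D ≤ r) (hrD : r ≤ D + 1)
    (hxy : G.dist x y = D + r) (hle : ∀ u v, G.dist u v ≤ D + r) :
    ∃ c c' par, IsCentralRooting G c c' x y par D r := by
  obtain ⟨c, hcx, hcy⟩ := hG.connected.exists_dist_eq hxy
  obtain ⟨par, h⟩ := hG.exists_isRooting c
  have hrk : ∀ i, i ≤ r → G.dist c (par^[i] y) = r - i := by
    intro i hi
    induction i with
    | zero => simpa using hcy
    | succ i ih =>
      have h1 := ih (by omega)
      have hne : par^[i] y ≠ c := by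
        intro e
        rw [e, SimpleGraph.dist_self] at h1
        omega
      have h2 := h.rk_par _ hne
      rw [Function.iterate_succ_apply']
      omega
  have hc1 := hrk (r - 1) (by omega)
  set c' := par^[r - 1] y with hc'
  have hne : c' ≠ c := by
    intro e
    rw [e, SimpleGraph.dist_self] at hc1
    omega
  have hpar : par c' = c := by
    have h1 := h.rk_par _ hne
    exact (hG.connected.dist_eq_zero_iff.1 (by omega)).symm
  have hy : IsDesc par y c' := ⟨r - 1, rfl⟩
  have hx : ¬ IsDesc par x c' := by
    -- If x were below c' too, the path from x to y could turn at c' instead of c and would have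
    -- length at most D + r - 2.
    rintro ⟨i, hi⟩
    have hrkx : ∀ i, par^[i] x ≠ c → G.dist c (par^[i] x) + i = D := by
      intro i
      induction i with
      | zero => exact fun _ => hcx
      | succ i ih =>
        intro hi
        rw [Function.iterate_succ_apply'] at hi ⊢
        have hne : par^[i] x ≠ c := by
          intro e
          rw [e, h.par_root] at hi
          exact hi rfl
        have h1 := ih hne
        have h2 := h.rk_par _ hne
        omega
    have h1 := hrkx i (hi ▸ hne)
    have h2 := h.dist_le_of_iterate x i
    have h3 := h.dist_le_of_iterate y (r - 1)
    have h4 := hG.connected.dist_triangle (u := x) (v := c') (w := y)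
    rw [hi] at h1 h2
    rw [← hc', SimpleGraph.dist_comm] at h3
    omega
  refine ⟨c, c', par, h, hne, hpar, hD, hrD, hx, hy, hcx, hcy, fun w hw => ?_, fun w hw => ?_⟩
  · have h1 := h.dist_eq_of_isDesc hy hw
    rw [hpar] at h1
    have h2 := hle w y
    rw [SimpleGraph.dist_comm] at h1 h2
    rw [SimpleGraph.dist_comm (u := w)] at h1
    omega
  · have h1 := h.dist_eq_of_isDesc hw hx
    rw [hpar, SimpleGraph.dist_comm (u := x) (v := c)] at h1
    have h2 := hle x w
    omega

namespace IsCentralRooting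

variable {V : Type*} {G : SimpleGraph V} {c c' x y : V} {par : V → V} {D r : ℕ}

theorem dist_child (h : IsCentralRooting G c c' x y par D r) : G.dist c c' = 1 := by
  have := h.rooting.rk_par c' h.ne
  rw [h.par_child, SimpleGraph.dist_self] at this
  omega

theorem dist_pos (h : IsCentralRooting G c c' x y par D r) {w : V} (hw : IsDesc par w c') :
    1 ≤ G.dist c w := by
  have := h.rooting.rk_le hw
  rw [h.dist_child] at this
  exact this

theorem one_le_r (h : IsCentralRooting G c c' x y par D r) : 1 ≤ r := by
  rw [← h.dist_y]
  exact h.dist_pos h.desc_y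

theorem not_isDesc_root (h : IsCentralRooting G c c' x y par D r) : ¬ IsDesc par c c' :=
  fun e => h.ne (h.rooting.isDesc_of_root e)

variable [Finite V]

open Classical in
-- Across the edge between c and c' distances add up through c, so x is farthest from a vertex below
-- c' and y is farthest from any other. Vertices on the same side are no farther away because D ≤ r
-- ≤ D + 1.
theorem vertexEcc_eq (h : IsCentralRooting G c c' x y par D r) (w : V) :
    vertexEcc G w = G.dist c w + if IsDesc par w c' then D else r := by
  have hconn := h.rooting.connected
  have hD := h.D_le
  have hr := h.r_le
  have cross : ∀ u v, IsDesc par u c' → ¬ IsDesc par v c' →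
      G.dist v u = G.dist c v + G.dist c u := by
    intro u v hu hv
    have := h.rooting.dist_eq_of_isDesc hu hv
    rwa [h.par_child, SimpleGraph.dist_comm (u := v) (v := c)] at this
  -- Below c' the way between two vertices may turn at c', which saves one step at each end.
  have inner : ∀ u, IsDesc par u c' → G.dist u c' + 1 ≤ G.dist c u := by
    intro u hu
    have key : ∀ i, par^[i] u = c' → G.dist c u = 1 + i := by
      clear hu
      intro i
      induction i generalizing u with
      | zero =>
        rintro rfl
        exact h.dist_child
      | succ i ih =>
        intro e
        have hne : u ≠ c := by
          rintro rfl
          rw [Function.iterate_fixed h.rooting.par_root] at e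
          exact h.ne e.symm
        have h1 := ih (par u) e
        have h2 := h.rooting.rk_par u hne
        omega
    obtain ⟨i, hi⟩ := hu
    have h1 := h.rooting.dist_le_of_iterate u i
    have h2 := key i hi
    rw [hi] at h1
    omega
  by_cases hw : IsDesc par w c'
  · rw [if_pos hw]
    refine _root_.vertexEcc_eq hconn (u := x) (fun z => ?_) ?_
    · by_cases hz : IsDesc par z c'
      · have h1 := inner w hw
        have h2 := inner z hz
        have h3 := h.le_r z hz
        have h4 := hconn.dist_triangle (u := w) (v := c') (w := z)
        rw [SimpleGraph.dist_comm (u := c')] at h4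
        omega
      · rw [SimpleGraph.dist_comm, cross w z hw hz]
        have := h.le_D z hz
        omega
    · rw [SimpleGraph.dist_comm, cross w x hw h.not_desc_x, h.dist_x]
      omega
  · rw [if_neg hw]
    refine _root_.vertexEcc_eq hconn (u := y) (fun z => ?_) ?_
    · by_cases hz : IsDesc par z c'
      · rw [cross z w hz hw]
        have := h.le_r z hz
        omega
      · have h1 := h.le_D z hz
        have h2 := hconn.dist_triangle (u := w) (v := c) (w := z)
        rw [SimpleGraph.dist_comm (u := w) (v := c)] at h2
        omega
    · rw [cross y w h.desc_y hw, h.dist_y]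

theorem le_vertexEcc (h : IsCentralRooting G c c' x y par D r) (w : V) : r ≤ vertexEcc G w := by
  have hr := h.r_le
  rw [h.vertexEcc_eq]
  split_ifs with hw
  · have := h.dist_pos hw
    omega
  · omega

theorem vertexEcc_le (h : IsCentralRooting G c c' x y par D r) (w : V) :
    vertexEcc G w ≤ D + r := by
  rw [h.vertexEcc_eq]
  split_ifs with hw
  · have := h.le_r w hw
    omega
  · have := h.le_D w hw
    omega

theorem vertexEcc_x (h : IsCentralRooting G c c' x y par D r) : vertexEcc G x = D + r := by
  rw [h.vertexEcc_eq, if_neg h.not_desc_x, h.dist_x]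

theorem vertexEcc_y (h : IsCentralRooting G c c' x y par D r) : vertexEcc G y = D + r := by
  rw [h.vertexEcc_eq, if_pos h.desc_y, h.dist_y, add_comm]

theorem vertexEcc_root (h : IsCentralRooting G c c' x y par D r) : vertexEcc G c = r := by
  rw [h.vertexEcc_eq, if_neg h.not_isDesc_root, SimpleGraph.dist_self, zero_add]

theorem vertexEcc_child (h : IsCentralRooting G c c' x y par D r) :
    vertexEcc G c' = D + 1 := by
  rw [h.vertexEcc_eq, if_pos (IsDesc.refl _), h.dist_child, add_comm]

theorem vertexEcc_eq_r_iff (h : IsCentralRooting G c c' x y par D r) (w : V) :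
    vertexEcc G w = r ↔ w = c ∨ (D < r ∧ w = c') := by
  have hr := h.r_le
  constructor
  · intro e
    rw [h.vertexEcc_eq] at e
    split_ifs at e with hw
    · have h1 := h.dist_pos hw
      refine Or.inr ⟨by omega, ?_⟩
      by_contra hne
      have h2 := h.rooting.rk_lt hw hne
      rw [h.dist_child] at h2
      omega
    · exact Or.inl (h.rooting.connected.dist_eq_zero_iff.1 (by omega)).symm
  · rintro (rfl | ⟨h1, rfl⟩)
    · exact h.vertexEcc_root
    · rw [h.vertexEcc_child]
      omega

/-- A vertex and its parent lie on the same side, so only the distance from c changes. The exception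
is w = c': there the hypothesis forces D = r, and the value drops from r + 1 to r. -/
theorem vertexEcc_par (h : IsCentralRooting G c c' x y par D r) {w : V}
    (hw : r < vertexEcc G w) : vertexEcc G (par w) + 1 = vertexEcc G w := by
  have hD := h.D_le
  have hwc : w ≠ c := by
    rintro rfl
    rw [h.vertexEcc_root] at hw
    omega
  by_cases hwc' : w = c'
  · subst hwc'
    rw [h.vertexEcc_child] at hw
    rw [h.vertexEcc_child, h.par_child, h.vertexEcc_root]
    omega
  · have h1 := h.rooting.rk_par w hwc
    have h2 : IsDesc par (par w) c' ↔ IsDesc par w c' :=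
      ⟨fun e => e.of_par, fun e => e.par_of_ne hwc'⟩
    rw [h.vertexEcc_eq, h.vertexEcc_eq]
    by_cases e : IsDesc par w c'
    · rw [if_pos e, if_pos (h2.2 e)]
      omega
    · rw [if_neg e, if_neg (mt h2.1 e)]
      omega

theorem vertexEcc_iterate (h : IsCentralRooting G c c' x y par D r) {w : V} {i : ℕ}
    (hi : r + i ≤ vertexEcc G w) : vertexEcc G (par^[i] w) + i = vertexEcc G w := by
  induction i with
  | zero => rfl
  | succ i ih =>
    have h1 := ih (by omega)
    have h2 := h.vertexEcc_par (w := par^[i] w) (by omega)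
    rw [Function.iterate_succ_apply']
    omega

theorem vertexEcc_par_le (h : IsCentralRooting G c c' x y par D r) (w : V) :
    vertexEcc G (par w) ≤ vertexEcc G w := by
  rcases (h.le_vertexEcc w).lt_or_eq with hw | hw
  · have := h.vertexEcc_par hw
    omega
  · have h1 : vertexEcc G (par w) = r := by
      rw [h.vertexEcc_eq_r_iff]
      rcases (h.vertexEcc_eq_r_iff w).1 hw.symm with rfl | ⟨-, rfl⟩
      · exact Or.inl h.rooting.par_root
      · exact Or.inl h.par_child
    omega

theorem vertexEcc_eq_add_of_iterate (h : IsCentralRooting G c c' x y par D r) {v w : V} {i : ℕ}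
    (hv : r < vertexEcc G v) (hi : par^[i] w = v) : vertexEcc G w = vertexEcc G v + i := by
  induction i generalizing v with
  | zero => exact hi ▸ rfl
  | succ i ih =>
    rw [Function.iterate_succ_apply'] at hi
    have h1 := h.vertexEcc_par_le (par^[i] w)
    rw [hi] at h1
    have h2 := h.vertexEcc_par (w := par^[i] w) (by omega)
    rw [hi] at h2
    have h3 := ih (v := par^[i] w) (by omega) rfl
    omega

end IsCentralRooting

/-! ### Bounding the edge sum level by level -/

/-- The largest possible value of the sum of `unsplitCount n k` over the edges of a tree of order `n`,
radius `r` and diameter `D + r` that has `m i` vertices of eccentricity `D + r - i`. -/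
def levelBound (n k : ℕ) (m : ℕ → ℕ) (D r : ℕ) : ℕ :=
  ∑ i ∈ Finset.range D, (unsplitCount n k (i + 1) + (m i - 2) * unsplitCount n k 1 +
    unsplitCount n k (∑ j ∈ Finset.range (i + 1), m j - (i + 1) - (m i - 2))) +
  if D < r then unsplitCount n k r else 0

open Classical in
/-- The number of vertices of eccentricity `e`. -/
noncomputable def eccCount {V : Type*} [Fintype V] (G : SimpleGraph V) (e : ℕ) : ℕ :=
  (Finset.univ.filter fun v => vertexEcc G v = e).card

namespace IsCentralRooting

variable {V : Type*} [Fintype V] [DecidableEq V] {G : SimpleGraph V} {c c' x y : V} {par : V → V}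
  {D r : ℕ}

theorem card_filter_le_vertexEcc (h : IsCentralRooting G c c' x y par D r) {i : ℕ}
    (hi : i ≤ D + r) : (Finset.univ.filter fun w => D + r - i ≤ vertexEcc G w).card =
      ∑ j ∈ Finset.range (i + 1), eccCount G (D + r - j) := by
  rw [Finset.card_eq_sum_card_fiberwise (f := fun w => D + r - vertexEcc G w)
    (t := Finset.range (i + 1))]
  · refine Finset.sum_congr rfl fun j hj => ?_
    rw [Finset.mem_range] at hj
    rw [eccCount]
    congr 1
    ext w
    have h1 := h.vertexEcc_le w
    simp only [Finset.mem_filter, Finset.mem_univ, true_and]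
    omega
  · intro w hw
    have hw' := (Finset.mem_filter.1 hw).2
    have h1 := h.vertexEcc_le w
    simp only [Finset.coe_range, Set.mem_Iio]
    omega

/-- A vertex w of eccentricity at least e has exactly one ancestor of eccentricity e, reached after
`vertexEcc G w - e` steps. So the descendant sets of this level are disjoint. -/
theorem sum_card_descendants (h : IsCentralRooting G c c' x y par D r) {e : ℕ} (he : r < e) :
    ∑ v ∈ Finset.univ.filter (fun v => vertexEcc G v = e), (descendants par v).card =
      (Finset.univ.filter fun w => e ≤ vertexEcc G w).card := by
  rw [Finset.card_eq_sum_card_fiberwise (f := fun w => par^[vertexEcc G w - e] w)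
    (t := Finset.univ.filter fun v => vertexEcc G v = e)]
  · refine Finset.sum_congr rfl fun v hv => ?_
    rw [Finset.mem_filter] at hv
    congr 1
    ext w
    rw [mem_descendants, Finset.mem_filter, Finset.mem_filter]
    constructor
    · rintro ⟨i, hi⟩
      have h1 := h.vertexEcc_eq_add_of_iterate (v := v) (by omega) hi
      refine ⟨⟨Finset.mem_univ _, by omega⟩, ?_⟩
      rw [h1, hv.2, Nat.add_sub_cancel_left, hi]
    · exact fun hw => ⟨_, hw.2⟩
  · intro w hw
    have hw' := (Finset.mem_filter.1 hw).2
    have := h.vertexEcc_iterate (w := w) (i := vertexEcc G w - e) (by omega)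
    refine Finset.mem_filter.2 ⟨Finset.mem_univ _, ?_⟩
    change vertexEcc G (par^[vertexEcc G w - e] w) = e
    omega

theorem iterate_injOn (h : IsCentralRooting G c c' x y par D r) {z : V} {i : ℕ}
    (hz : r + i ≤ vertexEcc G z) :
    Set.InjOn (fun j => par^[j] z) (Finset.range (i + 1)) := by
  intro a ha b hb hab
  simp only [Finset.coe_range, Set.mem_Iio] at ha hb hab
  have h1 := h.vertexEcc_iterate (w := z) (i := a) (by omega)
  have h2 := h.vertexEcc_iterate (w := z) (i := b) (by omega)
  rw [hab] at h1
  omega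

theorem card_iterates (h : IsCentralRooting G c c' x y par D r) {z : V} {i : ℕ}
    (hz : r + i ≤ vertexEcc G z) :
    ((Finset.range (i + 1)).image fun j => par^[j] z).card = i + 1 := by
  rw [Finset.card_image_of_injOn (h.iterate_injOn hz), Finset.card_range]

theorem iterates_subset_descendants (par : V → V) (z : V) (i : ℕ) :
    ((Finset.range (i + 1)).image fun j => par^[j] z) ⊆ descendants par (par^[i] z) := by
  intro w hw
  obtain ⟨j, hj, rfl⟩ := Finset.mem_image.1 hw
  rw [Finset.mem_range] at hj
  exact mem_descendants.2 ⟨i - j, by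
    rw [← Function.iterate_add_apply, Nat.sub_add_cancel (by omega)]⟩

theorem le_card_descendants (h : IsCentralRooting G c c' x y par D r) {z : V} {i : ℕ}
    (hz : r + i ≤ vertexEcc G z) : i + 1 ≤ (descendants par (par^[i] z)).card := by
  rw [← h.card_iterates hz]
  exact Finset.card_le_card (iterates_subset_descendants par z i)

/-- A vertex above both x and y cannot be c' or lie below it, so it is above c' and hence equals c.
But the eccentricity of `par^[i] x` still exceeds r. -/
theorem iterate_ne (h : IsCentralRooting G c c' x y par D r) {i : ℕ} (hi : i < D) (j : ℕ) :
    par^[i] x ≠ par^[j] y := by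
  intro e
  have hu := h.vertexEcc_iterate (w := x) (i := i) (by rw [h.vertexEcc_x]; omega)
  rw [h.vertexEcc_x] at hu
  have hx : IsDesc par x (par^[i] x) := ⟨i, rfl⟩
  have hy : IsDesc par y (par^[i] x) := ⟨j, e.symm⟩
  rcases hy.total h.desc_y with h1 | h1
  · exact h.not_desc_x (hx.trans h1)
  · by_cases h2 : c' = par^[i] x
    · exact h.not_desc_x (h2 ▸ hx)
    · have h3 := h1.par_of_ne h2
      rw [h.par_child] at h3
      rw [h.rooting.isDesc_of_root h3, h.vertexEcc_root] at hu
      omega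

/-- Edges are indexed by their lower ends. The only such end of eccentricity r is c', in the case D
< r of two central vertices. -/
theorem sum_erase_root (h : IsCentralRooting G c c' x y par D r) (f : V → ℕ) :
    ∑ v ∈ Finset.univ.erase c, f v =
      ∑ i ∈ Finset.range D, ∑ v ∈ Finset.univ.filter (fun v => vertexEcc G v = D + r - i), f v +
        if D < r then f c' else 0 := by
  have h1 : ∑ v ∈ Finset.univ.erase c, f v =
      ∑ v ∈ (Finset.univ.erase c).filter (fun v => r < vertexEcc G v), f v +
      ∑ v ∈ (Finset.univ.erase c).filter (fun v => ¬ r < vertexEcc G v), f v :=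
    (Finset.sum_filter_add_sum_filter_not _ _ _).symm
  rw [h1]
  congr 1
  · rw [← Finset.sum_fiberwise_of_maps_to (s := (Finset.univ.erase c).filter _)
      (t := Finset.range D) (g := fun v => D + r - vertexEcc G v)]
    · refine Finset.sum_congr rfl fun i hi => Finset.sum_congr ?_ fun _ _ => rfl
      rw [Finset.mem_range] at hi
      ext v
      simp only [Finset.mem_filter, Finset.mem_erase, Finset.mem_univ, and_true, true_and]
      have h2 := h.vertexEcc_le v
      constructor
      · rintro ⟨⟨-, h3⟩, h4⟩
        omega
      · intro h3
        refine ⟨⟨?_, by omega⟩, by omega⟩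
        rintro rfl
        rw [h.vertexEcc_root] at h3
        omega
    · intro v hv
      have h2 : r < vertexEcc G v := (Finset.mem_filter.1 hv).2
      have h3 := h.vertexEcc_le v
      rw [Finset.mem_range]
      omega
  · have h2 : (Finset.univ.erase c).filter (fun v => ¬ r < vertexEcc G v) =
        if D < r then {c'} else ∅ := by
      ext v
      have h3 := h.vertexEcc_eq_r_iff v
      have h4 := h.le_vertexEcc v
      have h5 := h.ne
      simp only [Finset.mem_filter, Finset.mem_erase, Finset.mem_univ, and_true]
      split_ifs with hD
      · rw [Finset.mem_singleton]
        constructor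
        · rintro ⟨h6, h7⟩
          rcases h3.1 (by omega) with rfl | h8
          · exact absurd rfl h6
          · exact h8.2
        · rintro rfl
          have := h3.2 (Or.inr ⟨hD, rfl⟩)
          exact ⟨h5, by omega⟩
      · simp only [Finset.notMem_empty, iff_false, not_and, not_not]
        intro h6
        by_contra h7
        rcases h3.1 (by omega) with rfl | h8
        · exact h6 rfl
        · exact hD h8.1
    rw [h2]
    split_ifs <;> simp

theorem iterate_x_eq_root (h : IsCentralRooting G c c' x y par D r) :
    par^[D] x = c := by
  have h1 := h.vertexEcc_iterate (w := x) (i := D) (by rw [h.vertexEcc_x]; omega)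
  rw [h.vertexEcc_x] at h1
  rcases (h.vertexEcc_eq_r_iff (par^[D] x)).1 (by omega) with h2 | h2
  · exact h2
  · exact absurd ⟨D, h2.2⟩ h.not_desc_x

theorem iterate_y_eq_child (h : IsCentralRooting G c c' x y par D r) :
    par^[r - 1] y = c' := by
  obtain ⟨j, hj⟩ := h.desc_y
  have hr := h.one_le_r
  have hr' := h.r_le
  have hD := h.D_le
  have h0 : j ≤ D := by
    by_contra hlt
    have h1 := h.vertexEcc_iterate (w := y) (i := D) (by rw [h.vertexEcc_y]; omega)
    rw [h.vertexEcc_y] at h1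
    obtain ⟨i, rfl⟩ : ∃ i, j = i + 1 + D := ⟨j - D - 1, by omega⟩
    rw [Function.iterate_add_apply, Function.iterate_succ_apply] at hj
    have h2 : par (par^[D] y) = c := by
      rcases (h.vertexEcc_eq_r_iff (par^[D] y)).1 (by omega) with h2 | h2
      · rw [h2, h.rooting.par_root]
      · rw [h2.2, h.par_child]
    rw [h2, Function.iterate_fixed h.rooting.par_root] at hj
    exact h.ne hj.symm
  have h1 := h.vertexEcc_iterate (w := y) (i := j) (by rw [h.vertexEcc_y]; omega)
  rw [hj, h.vertexEcc_y, h.vertexEcc_child] at h1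
  rw [← hj]
  congr 1
  omega

theorem le_card_descendants_child (h : IsCentralRooting G c c' x y par D r) :
    r ≤ (descendants par c').card := by
  have h0 := h.one_le_r
  have h1 := h.le_card_descendants (z := y) (i := r - 1)
    (by rw [h.vertexEcc_y]; have := h.r_le; omega)
  rw [h.iterate_y_eq_child] at h1
  omega

theorem iterates_x_subset (h : IsCentralRooting G c c' x y par D r) :
    ((Finset.range (D + 1)).image fun j => par^[j] x) ⊆ (descendants par c')ᶜ := by
  intro w hw
  obtain ⟨j, -, rfl⟩ := Finset.mem_image.1 hw
  rw [Finset.mem_compl, mem_descendants]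
  exact fun hd => h.not_desc_x (IsDesc.trans ⟨j, rfl⟩ hd)

theorem le_card_compl_descendants_child (h : IsCentralRooting G c c' x y par D r) :
    D + 1 ≤ ((descendants par c')ᶜ).card := by
  rw [← h.card_iterates (z := x) (i := D) (by rw [h.vertexEcc_x]; omega)]
  exact Finset.card_le_card h.iterates_x_subset

theorem sum_level_card (h : IsCentralRooting G c c' x y par D r) {i : ℕ} (hi : i < D) :
    ∑ v ∈ Finset.univ.filter (fun v => vertexEcc G v = D + r - i), (descendants par v).card =
      ∑ j ∈ Finset.range (i + 1), eccCount G (D + r - j) := by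
  rw [h.sum_card_descendants (by omega), h.card_filter_le_vertexEcc (by omega)]

theorem one_le_card_descendants (par : V → V) (v : V) : 1 ≤ (descendants par v).card :=
  Finset.card_pos.2 ⟨v, mem_descendants.2 (IsDesc.refl v)⟩

theorem level_card (e : ℕ) :
    (Finset.univ.filter (fun v => vertexEcc G v = e)).card = eccCount G e := by
  rw [eccCount]

theorem mem_level (h : IsCentralRooting G c c' x y par D r) {z : V} {i : ℕ} (hi : i < D)
    (hz : vertexEcc G z = D + r) :
    par^[i] z ∈ Finset.univ.filter (fun v => vertexEcc G v = D + r - i) := by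
  have := h.vertexEcc_iterate (w := z) (i := i) (by omega)
  rw [Finset.mem_filter]
  exact ⟨Finset.mem_univ _, by omega⟩

theorem level_le (h : IsCentralRooting G c c' x y par D r) (k : ℕ) {i : ℕ} (hi : i < D) :
    ∑ v ∈ Finset.univ.filter (fun v => vertexEcc G v = D + r - i),
      unsplitCount (Fintype.card V) k (descendants par v).card ≤
    unsplitCount (Fintype.card V) k (i + 1) +
      (eccCount G (D + r - i) - 2) * unsplitCount (Fintype.card V) k 1 +
      unsplitCount (Fintype.card V) k (∑ j ∈ Finset.range (i + 1), eccCount G (D + r - j) -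
        (i + 1) - (eccCount G (D + r - i) - 2)) := by
  have h1 := sum_unsplitCount_le (n := Fintype.card V) (s := fun v => (descendants par v).card) k
    (h.mem_level hi h.vertexEcc_x) (h.mem_level hi h.vertexEcc_y) (h.iterate_ne hi i)
    (q := i + 1) (by omega)
    (h.le_card_descendants (by rw [h.vertexEcc_x]; omega))
    (h.le_card_descendants (by rw [h.vertexEcc_y]; omega))
    (fun w _ => one_le_card_descendants par w)
    (by rw [h.sum_card_descendants (by omega)]; exact Finset.card_le_univ _)
  rwa [h.sum_level_card hi, level_card] at h1

/-- Both sides of the central edge have at least r vertices. Convexity for the pair s, n - s, whose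
values of F agree, gives 2 F(s) ≤ 2 F(r). -/
theorem child_le (h : IsCentralRooting G c c' x y par D r) (k : ℕ) (hD : D < r) :
    unsplitCount (Fintype.card V) k (descendants par c').card ≤
      unsplitCount (Fintype.card V) k r := by
  have h1 := h.le_card_descendants_child
  have h2 := h.le_card_compl_descendants_child
  have h4 := h.r_le
  have h5 := Finset.card_le_univ (descendants par c')
  rw [Finset.card_compl] at h2
  have h3 := unsplitCount_add_le k (n := Fintype.card V) (q := r) (a := (descendants par c').card)
    (b := Fintype.card V - (descendants par c').card) (by omega) (by omega) (by omega)
  rw [Nat.add_sub_cancel' (by omega), unsplitCount_compl k (by omega),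
    unsplitCount_compl k (by omega)] at h3
  omega

theorem sum_le_levelBound (h : IsCentralRooting G c c' x y par D r) (k : ℕ) :
    ∑ v ∈ Finset.univ.erase c, unsplitCount (Fintype.card V) k (descendants par v).card ≤
      levelBound (Fintype.card V) k (fun i => eccCount G (D + r - i)) D r := by
  rw [h.sum_erase_root, levelBound]
  refine add_le_add (Finset.sum_le_sum fun i hi => h.level_le k (Finset.mem_range.1 hi)) ?_
  split_ifs with hD
  · exact h.child_le k hD
  · exact le_rfl

theorem card_descendants_of_vertexEcc_eq (h : IsCentralRooting G c c' x y par D r) (hD : 0 < D)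
    {v : V} (hv : vertexEcc G v = D + r) : (descendants par v).card = 1 := by
  rw [Finset.card_eq_one]
  refine ⟨v, Finset.eq_singleton_iff_unique_mem.2
    ⟨mem_descendants.2 (IsDesc.refl v), fun w hw => ?_⟩⟩
  obtain ⟨i, hi⟩ := mem_descendants.1 hw
  have h1 := h.vertexEcc_eq_add_of_iterate (by omega) hi
  have h2 := h.vertexEcc_le w
  obtain rfl : i = 0 := by omega
  exact hi

/-- Equality of the sums forces equality in every level and at the central edge. The single
condition k + r ≤ n suffices for strictness, as all thresholds i + 1 are at most D ≤ r. -/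
theorem tight_of_sum_eq (h : IsCentralRooting G c c' x y par D r) {k : ℕ} (hk : 2 ≤ k)
    (hkr : k + r ≤ Fintype.card V)
    (heq : ∑ v ∈ Finset.univ.erase c, unsplitCount (Fintype.card V) k (descendants par v).card =
      levelBound (Fintype.card V) k (fun i => eccCount G (D + r - i)) D r) :
    (∀ i < D, ((descendants par (par^[i] x)).card = i + 1 ∨
      (descendants par (par^[i] y)).card = i + 1) ∧ ∀ w, vertexEcc G w = D + r - i →
      w ≠ par^[i] x → w ≠ par^[i] y → (descendants par w).card = 1) ∧
    (D < r → (descendants par c').card = r ∨ ((descendants par c')ᶜ).card = D + 1) := by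
  rw [h.sum_erase_root, levelBound] at heq
  have h1 := Finset.sum_le_sum fun i hi => h.level_le k (i := i) (Finset.mem_range.1 hi)
  have h2 : (if D < r then unsplitCount (Fintype.card V) k (descendants par c').card else 0) ≤
      if D < r then unsplitCount (Fintype.card V) k r else 0 := by
    split_ifs with hD
    · exact h.child_le k hD
    · exact le_rfl
  have h3 := le_antisymm h1 (by omega)
  have h4 := le_antisymm h2 (by omega)
  rw [Finset.sum_eq_sum_iff_of_le fun i hi => h.level_le k (Finset.mem_range.1 hi)] at h3
  constructor
  · intro i hi
    -- In the outermost level all sizes are 1 anyway; the equality lemma does not cover q = 1.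
    rcases Nat.eq_zero_or_pos i with rfl | hpos
    · exact ⟨Or.inl (h.card_descendants_of_vertexEcc_eq hi h.vertexEcc_x),
        fun w hw _ _ => h.card_descendants_of_vertexEcc_eq hi hw⟩
    · have hD := h.D_le
      have h5 := h3 i (Finset.mem_range.2 hi)
      rw [← h.sum_level_card hi, ← level_card] at h5
      have h6 := eq_of_sum_unsplitCount_eq (n := Fintype.card V)
        (s := fun v => (descendants par v).card) hk (q := i + 1) (by omega)
        (h.mem_level hi h.vertexEcc_x) (h.mem_level hi h.vertexEcc_y) (h.iterate_ne hi i)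
        (by omega)
        (h.le_card_descendants (by rw [h.vertexEcc_x]; omega))
        (h.le_card_descendants (by rw [h.vertexEcc_y]; omega))
        (fun w _ => one_le_card_descendants par w)
        (by rw [h.sum_card_descendants (by omega)]; exact Finset.card_le_univ _) h5
      exact ⟨h6.1, fun w hw => h6.2 w (Finset.mem_filter.2 ⟨Finset.mem_univ _, hw⟩)⟩
  · intro hD
    rw [if_pos hD, if_pos hD] at h4
    have h5 := h.le_card_descendants_child
    have h6 := h.le_card_compl_descendants_child
    have hr := h.r_le
    by_contra! hcon
    rw [Finset.card_compl] at h6 hcon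
    have h7 := unsplitCount_add_lt (k := k) (n := Fintype.card V) (q := r)
      (a := (descendants par c').card) (b := Fintype.card V - (descendants par c').card) hk hkr
      (by omega) (by omega) (by omega)
    rw [Nat.add_sub_cancel' (by omega), unsplitCount_compl k (by omega),
      unsplitCount_compl k (by omega)] at h7
    omega

end IsCentralRooting

/-! ### Paths with pendent vertices -/

namespace PendentPath

variable {d : ℕ} {a : ℕ → ℕ}

/-- The parent function of a path with pendent vertices, rooted at the last vertex of the path. -/
def parent : PendentPathVertex d a → PendentPathVertex d a
  | .inl i => .inl ⟨min (i.1 + 1) d, by omega⟩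
  | .inr p => .inl p.1

/-- The distance from the last vertex of the path. -/
def height : PendentPathVertex d a → ℕ
  | .inl i => d - i.1
  | .inr p => d - p.1.1 + 1

/-- Any root gives the same index. With the end of the path as root, the descendants of a path
vertex are an initial piece of the path with its pendent vertices, so cut sizes become partial sums.
-/
theorem isRooting (d : ℕ) (a : ℕ → ℕ) :
    IsRooting (pendentPath d a) (.inl (Fin.last d)) parent height := by
  refine ⟨?_, ?_, ?_⟩
  · simp only [parent, Fin.val_last, Sum.inl.injEq]
    ext
    simp
  · rintro (i | p) h
    · have h1 : i.1 ≠ d := fun e => h (congrArg _ (Fin.ext e))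
      have h2 := i.2
      simp only [parent, height]
      omega
    · simp [parent, height]
  · rintro (i | p) (j | q)
    · have h1 : (pendentPath d a).Adj (.inl i) (.inl j) ↔ (i.1 + 1 = j.1 ∨ j.1 + 1 = i.1) :=
        SimpleGraph.pathGraph_adj
      rw [h1]
      simp only [parent, ne_eq, Sum.inl.injEq, Fin.ext_iff, Fin.val_last]
      omega
    · have h1 : (pendentPath d a).Adj (.inl i) (.inr q) ↔ q.1 = i := Iff.rfl
      rw [h1]
      simp [parent]
    · have h1 : (pendentPath d a).Adj (.inr p) (.inl j) ↔ p.1 = j := Iff.rfl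
      rw [h1]
      simp [parent]
    · have h1 : (pendentPath d a).Adj (.inr p) (.inr q) ↔ False := Iff.rfl
      rw [h1]
      simp [parent]

theorem isTree (d : ℕ) (a : ℕ → ℕ) : (pendentPath d a).IsTree := (isRooting d a).isTree

theorem parent_iterate_inl (i : Fin (d + 1)) (t : ℕ) :
    (parent (a := a))^[t] (.inl i) = .inl ⟨min (i.1 + t) d, by omega⟩ := by
  induction t with
  | zero =>
    simp only [Function.iterate_zero, id_eq, Sum.inl.injEq, Fin.ext_iff]
    omega
  | succ t ih =>
    rw [Function.iterate_succ_apply', ih]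
    simp only [parent, Sum.inl.injEq, Fin.ext_iff]
    omega

theorem isDesc_inl_inl (i j : Fin (d + 1)) :
    IsDesc (parent (a := a)) (.inl j) (.inl i) ↔ j.1 ≤ i.1 := by
  constructor
  · rintro ⟨t, ht⟩
    rw [parent_iterate_inl] at ht
    simp only [Sum.inl.injEq, Fin.ext_iff] at ht
    omega
  · intro h
    refine ⟨i.1 - j.1, ?_⟩
    rw [parent_iterate_inl]
    simp only [Sum.inl.injEq, Fin.ext_iff]
    omega

theorem isDesc_inr_inl (i : Fin (d + 1)) (p : Σ i : Fin (d + 1), Fin (a i)) :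
    IsDesc (parent (a := a)) (.inr p) (.inl i) ↔ p.1.1 ≤ i.1 := by
  rw [← isDesc_inl_inl (a := a)]
  exact ⟨fun h => h.par_of_ne (by simp), fun h => IsDesc.of_par (w := Sum.inr p) h⟩

theorem isDesc_inr (p : Σ i : Fin (d + 1), Fin (a i)) (w : PendentPathVertex d a) :
    IsDesc parent w (.inr p) ↔ w = .inr p := by
  constructor
  · rintro ⟨_ | t, ht⟩
    · exact ht
    · rw [Function.iterate_succ_apply'] at ht
      cases h : parent^[t] w <;> rw [h] at ht <;> simp [parent] at ht
  · rintro rfl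
    exact IsDesc.refl _

theorem card_descendants_inr (p : Σ i : Fin (d + 1), Fin (a i)) :
    (descendants (parent (a := a)) (.inr p)).card = 1 := by
  rw [Finset.card_eq_one]
  refine ⟨.inr p, ?_⟩
  ext w
  rw [mem_descendants, isDesc_inr, Finset.mem_singleton]

theorem sum_ite_le (f : ℕ → ℕ) (i : Fin (d + 1)) :
    ∑ j : Fin (d + 1), (if j.1 ≤ i.1 then f j else 0) = ∑ j ∈ Finset.range (i.1 + 1), f j := by
  rw [Fin.sum_univ_eq_sum_range (fun j => if j ≤ i.1 then f j else 0), ← Finset.sum_filter]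
  refine Finset.sum_congr ?_ fun _ _ => rfl
  ext j
  have := i.2
  simp only [Finset.mem_filter, Finset.mem_range]
  omega

theorem card_descendants_inl (i : Fin (d + 1)) :
    (descendants (parent (a := a)) (.inl i)).card =
      ∑ j ∈ Finset.range (i.1 + 1), (a j + 1) := by
  classical
  rw [← sum_ite_le, descendants, Finset.card_filter, Fintype.sum_sum_type, Fintype.sum_sigma,
    ← Finset.sum_add_distrib]
  refine Finset.sum_congr rfl fun j _ => ?_
  simp only [isDesc_inl_inl, isDesc_inr_inl]
  split_ifs
  · simp [add_comm]
  · simp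

theorem card_vertex (d : ℕ) (a : ℕ → ℕ) :
    Fintype.card (PendentPathVertex d a) = ∑ j ∈ Finset.range (d + 1), (a j + 1) := by
  rw [← Fin.val_last d, ← card_descendants_inl (a := a) (Fin.last d), ← Finset.card_univ]
  congr 1
  ext w
  rw [mem_descendants]
  exact ⟨fun _ => (isRooting d a).isDesc_root w, fun _ => Finset.mem_univ w⟩

/-- The sum of `unsplitCount n k` over the edges of a path with pendent vertices. -/
def edgeSum (n k d : ℕ) (a : ℕ → ℕ) : ℕ :=
  ∑ i ∈ Finset.range d, unsplitCount n k (∑ j ∈ Finset.range (i + 1), (a j + 1)) +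
    (∑ j ∈ Finset.range (d + 1), a j) * unsplitCount n k 1

theorem steinerWiener_add {k : ℕ} (hk : 1 ≤ k) {n : ℕ}
    (hn : Fintype.card (PendentPathVertex d a) = n) :
    steinerWiener k (pendentPath d a) + edgeSum n k d a = (n - 1) * n.choose k := by
  subst hn
  rw [← (isRooting d a).steinerWiener_add hk]
  congr 1
  set n := Fintype.card (PendentPathVertex d a)
  have h1 := Finset.add_sum_erase Finset.univ
    (fun v : PendentPathVertex d a => unsplitCount n k (descendants parent v).card)
    (Finset.mem_univ (.inl (Fin.last d)))
  rw [Fintype.sum_sum_type, Fin.sum_univ_castSucc] at h1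
  simp only [card_descendants_inl, card_descendants_inr, Fin.val_castSucc] at h1
  rw [Fin.sum_univ_eq_sum_range (fun i => unsplitCount n k
    (∑ j ∈ Finset.range (i + 1), (a j + 1)))] at h1
  have h2 : ∑ _p : (Σ i : Fin (d + 1), Fin (a i)), unsplitCount n k 1 =
      (∑ j ∈ Finset.range (d + 1), a j) * unsplitCount n k 1 := by
    rw [Finset.sum_const, Finset.card_univ, Fintype.card_sigma, smul_eq_mul]
    simp only [Fintype.card_fin]
    rw [Fin.sum_univ_eq_sum_range a]
  rw [h2] at h1
  rw [edgeSum]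
  omega

/-- Used for lower bounds on distances to the two ends: `pos + depth` and `d - pos + depth` change
by at most one along an edge. -/
theorem dist_lipschitz {V : Type*} {G : SimpleGraph V} (hG : G.Connected) (f : V → ℕ)
    (hf : ∀ u v, G.Adj u v → f u ≤ f v + 1) (u v : V) : f u ≤ f v + G.dist u v := by
  obtain ⟨p, hp⟩ := hG.exists_walk_length_eq_dist u v
  rw [← hp]
  clear hp
  induction p with
  | nil => simp
  | cons h p ih =>
    have := hf _ _ h
    rw [SimpleGraph.Walk.length_cons]
    omega

/-- The position of the path vertex to which a vertex is attached. -/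
def pos : PendentPathVertex d a → ℕ
  | .inl i => i.1
  | .inr p => p.1.1

/-- The distance of a vertex from the path. -/
def depth : PendentPathVertex d a → ℕ
  | .inl _ => 0
  | .inr _ => 1

theorem pos_le (v : PendentPathVertex d a) : pos v ≤ d := by
  rcases v with i | p
  · exact Nat.lt_succ_iff.1 i.2
  · exact Nat.lt_succ_iff.1 p.1.2

theorem dist_inl_le {i j : Fin (d + 1)} (h : i ≤ j) :
    (pendentPath d a).dist (.inl i) (.inl j) ≤ j.1 - i.1 := by
  have h1 := (isRooting d a).dist_le_of_iterate (.inl i) (j.1 - i.1)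
  rw [parent_iterate_inl] at h1
  have h2 : (⟨min (i.1 + (j.1 - i.1)) d, by omega⟩ : Fin (d + 1)) = j := by
    ext
    have h3 : i.1 ≤ j.1 := h
    have h4 := j.2
    simp only []
    omega
  rwa [h2] at h1

theorem dist_le_depth (v : PendentPathVertex d a) :
    (pendentPath d a).dist v (.inl ⟨pos v, Nat.lt_succ_of_le (pos_le v)⟩) ≤ depth v := by
  rcases v with i | p
  · simp [pos, depth]
  · exact (isRooting d a).dist_le_of_iterate (.inr p) 1

theorem dist_le {u v : PendentPathVertex d a} (h : pos u ≤ pos v) :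
    (pendentPath d a).dist u v ≤ depth u + (pos v - pos u) + depth v := by
  have hconn := (isRooting d a).connected
  have h1 := dist_le_depth u
  have h2 := dist_le_depth v
  have h3 := dist_inl_le (a := a) (i := ⟨pos u, Nat.lt_succ_of_le (pos_le u)⟩)
    (j := ⟨pos v, Nat.lt_succ_of_le (pos_le v)⟩) h
  have h4 := hconn.dist_triangle (u := u) (v := .inl ⟨pos u, Nat.lt_succ_of_le (pos_le u)⟩) (w := v)
  have h5 := hconn.dist_triangle (u := .inl ⟨pos u, Nat.lt_succ_of_le (pos_le u)⟩)
    (v := .inl ⟨pos v, Nat.lt_succ_of_le (pos_le v)⟩) (w := v)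
  rw [SimpleGraph.dist_comm (u := v)] at h2
  simp only [] at h3
  omega

theorem le_dist_zero (v : PendentPathVertex d a) :
    pos v + depth v ≤ (pendentPath d a).dist v (.inl 0) := by
  have := dist_lipschitz (isRooting d a).connected (fun v => pos v + depth v) ?_ v (.inl 0)
  · simpa [pos, depth] using this
  · intro u v h
    rcases ((isRooting d a).adj_iff u v).1 h with ⟨h1, rfl⟩ | ⟨h1, rfl⟩
    · rcases u with i | p <;> simp only [pos, depth, parent] <;> omega
    · rcases v with i | p <;> simp only [pos, depth, parent] <;> omega

theorem le_dist_last (v : PendentPathVertex d a) :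
    d - pos v + depth v ≤ (pendentPath d a).dist v (.inl (Fin.last d)) := by
  have := dist_lipschitz (isRooting d a).connected (fun v => d - pos v + depth v) ?_ v
    (.inl (Fin.last d))
  · simpa [pos, depth] using this
  · intro u v h
    rcases ((isRooting d a).adj_iff u v).1 h with ⟨h1, rfl⟩ | ⟨h1, rfl⟩
    · rcases u with i | p <;> simp only [pos, depth, parent] <;> omega
    · rcases v with i | p <;> simp only [pos, depth, parent] <;> omega

theorem depth_le_pos (h0 : a 0 = 0) (v : PendentPathVertex d a) : depth v ≤ pos v := by
  rcases v with i | ⟨i, q⟩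
  · simp [depth]
  · simp only [depth, pos]
    by_contra hlt
    have h1 : i.1 = 0 := by omega
    have h2 : 0 < a i.1 := Nat.lt_of_le_of_lt (Nat.zero_le _) q.2
    rw [h1, h0] at h2
    omega

theorem depth_le_sub_pos (hd : a d = 0) (v : PendentPathVertex d a) :
    depth v ≤ d - pos v := by
  rcases v with i | ⟨i, q⟩
  · simp [depth]
  · simp only [depth, pos]
    by_contra hlt
    have h1 : i.1 = d := by omega
    have h2 : 0 < a i.1 := Nat.lt_of_le_of_lt (Nat.zero_le _) q.2
    rw [h1, hd] at h2
    omega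

/-- Without pendent vertices at the ends, no vertex reaches beyond the path, so an end of the path
is always farthest. -/
theorem dist_le_max (h0 : a 0 = 0) (hd : a d = 0) (v w : PendentPathVertex d a) :
    (pendentPath d a).dist v w ≤ max (pos v) (d - pos v) + depth v := by
  have h1 := depth_le_pos h0 w
  have h2 := depth_le_sub_pos hd w
  rcases le_total (pos v) (pos w) with h | h
  · have := dist_le h
    have := pos_le w
    omega
  · have := dist_le h
    rw [SimpleGraph.dist_comm] at this
    have := pos_le v
    omega

theorem vertexEcc_eq (h0 : a 0 = 0) (hd : a d = 0) (v : PendentPathVertex d a) :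
    vertexEcc (pendentPath d a) v = max (pos v) (d - pos v) + depth v := by
  rcases le_total (pos v) (d - pos v) with h | h
  · refine _root_.vertexEcc_eq (isRooting d a).connected (dist_le_max h0 hd v)
      (u := .inl (Fin.last d)) (le_antisymm (dist_le_max h0 hd v _) ?_)
    have := le_dist_last v
    omega
  · refine _root_.vertexEcc_eq (isRooting d a).connected (dist_le_max h0 hd v)
      (u := .inl 0) (le_antisymm (dist_le_max h0 hd v _) ?_)
    have := le_dist_zero v
    omega

theorem eccCount_eq (h0 : a 0 = 0) (hd : a d = 0) (e : ℕ) :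
    eccCount (pendentPath d a) e = ∑ i ∈ Finset.range (d + 1),
      ((if max i (d - i) = e then 1 else 0) + if max i (d - i) + 1 = e then a i else 0) := by
  classical
  rw [eccCount, Finset.card_filter, Fintype.sum_sum_type, Fintype.sum_sigma,
    ← Finset.sum_add_distrib, ← Fin.sum_univ_eq_sum_range (fun i =>
      (if max i (d - i) = e then 1 else 0) + if max i (d - i) + 1 = e then a i else 0)]
  refine Finset.sum_congr rfl fun i _ => ?_
  simp only [vertexEcc_eq h0 hd, pos, depth, add_zero]
  congr 1
  split_ifs <;> simp

theorem congr_iso {d' : ℕ} {a' : ℕ → ℕ} (hd : d = d') (h : ∀ i ≤ d, a i = a' i) :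
    Nonempty (pendentPath d a ≃g pendentPath d' a') := by
  subst hd
  refine ⟨⟨Equiv.sumCongr (Equiv.refl _) (Equiv.sigmaCongrRight fun i =>
    finCongr (h i (Nat.lt_succ_iff.1 i.2))), ?_⟩⟩
  rintro (i | p) (j | q) <;> rfl

end PendentPath

/-! ### The standard tree attains the bound -/

namespace PendentPath

section Numeric

variable {m a : ℕ → ℕ} {D r n : ℕ}

/-- Position 0 holds one vertex and position j + 1 holds m j - 1: the path vertex and its m j - 2
pendent neighbours. -/
theorem sum_pendents_add (h0 : a 0 = 0) (ha : ∀ i < D, a (i + 1) = m i - 2)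
    (hm : ∀ i < D, 2 ≤ m i) {i : ℕ} (hi : i ≤ D) :
    ∑ j ∈ Finset.range (i + 1), (a j + 1) + i = ∑ j ∈ Finset.range i, m j + 1 := by
  induction i with
  | zero => simp [h0]
  | succ i ih =>
    have h1 := ih (by omega)
    have h2 := hm i (by omega)
    rw [Finset.sum_range_succ (fun j => a j + 1) (i + 1), Finset.sum_range_succ m i,
      ha i (by omega)]
    omega

theorem sum_pendents_of_le (ha' : ∀ i, D < i → a i = 0) (t : ℕ) :
    ∑ j ∈ Finset.range (D + t + 1), (a j + 1) =
      ∑ j ∈ Finset.range (D + 1), (a j + 1) + t := by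
  induction t with
  | zero => rfl
  | succ t ih =>
    rw [show D + (t + 1) + 1 = (D + t + 1) + 1 by omega, Finset.sum_range_succ, ih,
      ha' _ (by omega)]
    omega

theorem sum_pendents (hD : D ≤ r) (h0 : a 0 = 0) (ha : ∀ i < D, a (i + 1) = m i - 2)
    (ha' : ∀ i, D < i → a i = 0) (hm : ∀ i < D, 2 ≤ m i)
    (hn : n = ∑ i ∈ Finset.range D, m i + (r - D + 1)) :
    ∑ j ∈ Finset.range (D + r + 1), (a j + 1) = n := by
  have h1 := sum_pendents_add h0 ha hm le_rfl
  have h2 := sum_pendents_of_le ha' r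
  omega

/-- The path edges before position D cut off the large parts of the levels, those after it the parts
of sizes r, ..., 1 at the far end, and the pendent edges the parts of size 1. For r = D + 1 the size
r belongs to the central edge. -/
theorem edgeSum_eq_levelBound (k : ℕ) (hD : D ≤ r) (hrD : r ≤ D + 1) (h0 : a 0 = 0)
    (ha : ∀ i < D, a (i + 1) = m i - 2) (ha' : ∀ i, D < i → a i = 0) (hm : ∀ i < D, 2 ≤ m i)
    (hn : n = ∑ i ∈ Finset.range D, m i + (r - D + 1)) :
    edgeSum n k (D + r) a = levelBound n k m D r := by
  have htot := sum_pendents hD h0 ha ha' hm hn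
  have hA := sum_pendents_of_le (D := D) ha'
  have h1 : ∑ i ∈ Finset.range D, unsplitCount n k (∑ j ∈ Finset.range (i + 1), (a j + 1)) =
      ∑ i ∈ Finset.range D, unsplitCount n k
        (∑ j ∈ Finset.range (i + 1), m j - (i + 1) - (m i - 2)) := by
    refine Finset.sum_congr rfl fun i hi => ?_
    rw [Finset.mem_range] at hi
    have h2 := sum_pendents_add h0 ha hm hi.le
    have h3 := hm i hi
    congr 1
    rw [Finset.sum_range_succ m]
    omega
  have h2 : ∑ t ∈ Finset.range r, unsplitCount n k
      (∑ j ∈ Finset.range (D + t + 1), (a j + 1)) =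
      ∑ i ∈ Finset.range D, unsplitCount n k (i + 1) +
        if D < r then unsplitCount n k r else 0 := by
    have h3 : ∑ t ∈ Finset.range r, unsplitCount n k
        (∑ j ∈ Finset.range (D + t + 1), (a j + 1)) =
        ∑ t ∈ Finset.range r, unsplitCount n k (t + 1) := by
      -- The path edge at D + t leaves r - t vertices at the far end, so the sum is read backwards.
      rw [← Finset.sum_range_reflect (fun t => unsplitCount n k (t + 1))]
      refine Finset.sum_congr rfl fun t ht => ?_
      rw [Finset.mem_range] at ht
      have h4 := hA t
      have h5 := hA r
      rw [← unsplitCount_compl k (by omega)]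
      congr 1
      omega
    rw [h3]
    split_ifs with hlt
    · obtain rfl : r = D + 1 := by omega
      rw [Finset.sum_range_succ]
    · obtain rfl : r = D := by omega
      rfl
  have h3 : ∑ j ∈ Finset.range (D + r + 1), a j = ∑ i ∈ Finset.range D, (m i - 2) := by
    rw [Finset.sum_range_succ', h0, add_zero, Finset.sum_range_add]
    rw [Finset.sum_eq_zero (s := Finset.range r) fun t _ => ha' _ (by omega), add_zero]
    exact Finset.sum_congr rfl fun i hi => ha i (Finset.mem_range.1 hi)
  rw [edgeSum, levelBound, Finset.sum_range_add, h1, h2, h3, Finset.sum_mul,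
    Finset.sum_add_distrib, Finset.sum_add_distrib]
  omega

end Numeric

/-! ### Recognising a path with pendent vertices -/

section Spine

variable {V : Type*} [Fintype V] {G : SimpleGraph V} {d : ℕ} {a : ℕ → ℕ}

theorem nonempty_iso_of_spine (p : ℕ → V) (att : V → ℕ)
    (hinj : ∀ i ≤ d, ∀ j ≤ d, p i = p j → i = j)
    (hpath : ∀ i ≤ d, ∀ j ≤ d, (G.Adj (p i) (p j) ↔ i + 1 = j ∨ j + 1 = i))
    (hatt : ∀ w, (∀ i ≤ d, p i ≠ w) → att w ≤ d ∧ ∀ v, G.Adj w v ↔ v = p (att w))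
    (hcount : ∀ i ≤ d, Nat.card {w // (∀ j ≤ d, p j ≠ w) ∧ att w = i} = a i) :
    Nonempty (G ≃g pendentPath d a) := by
  classical
  have hle : ∀ i : Fin (d + 1), i.1 ≤ d := fun i => Nat.lt_succ_iff.1 i.2
  have he : ∀ i : Fin (d + 1), Nonempty
      (Fin (a i) ≃ {w // (∀ j ≤ d, p j ≠ w) ∧ att w = i.1}) := fun i => by
    rw [← hcount i (hle i)]
    exact ⟨(Finite.equivFin _).symm⟩
  let e := fun i => (he i).some
  let f : PendentPathVertex d a → V :=
    Sum.elim (fun i => p i.1) (fun q => (e q.1 q.2).1)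
  have hne : ∀ (q : Σ i : Fin (d + 1), Fin (a i)) (j : ℕ), j ≤ d → p j ≠ f (.inr q) :=
    fun q => (e q.1 q.2).2.1
  have hattq : ∀ q : Σ i : Fin (d + 1), Fin (a i), att (f (.inr q)) = q.1.1 :=
    fun q => (e q.1 q.2).2.2
  have hbij : Function.Bijective f := by
    constructor
    · rintro (i | q) (j | s) h
      · exact congrArg _ (Fin.ext (hinj i (hle i) j (hle j) h))
      · exact absurd h (hne s i (hle i))
      · exact absurd h.symm (hne q j (hle j))
      · have h1 := (hattq q).symm.trans ((congrArg att h).trans (hattq s))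
        obtain ⟨i, q⟩ := q
        obtain ⟨j, s⟩ := s
        obtain rfl : i = j := Fin.ext h1
        have h2 : q = s := (e i).injective (Subtype.ext h)
        rw [h2]
    · intro w
      by_cases hw : ∃ i ≤ d, p i = w
      · obtain ⟨i, hi, rfl⟩ := hw
        exact ⟨.inl ⟨i, Nat.lt_succ_of_le hi⟩, rfl⟩
      · push Not at hw
        have h1 := (hatt w hw).1
        refine ⟨.inr ⟨⟨att w, Nat.lt_succ_of_le h1⟩,
          (e ⟨att w, Nat.lt_succ_of_le h1⟩).symm ⟨w, hw, rfl⟩⟩, ?_⟩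
        simp [f]
  have hadj : ∀ u v, G.Adj (f u) (f v) ↔ (pendentPath d a).Adj u v := by
    have hin : ∀ (i : Fin (d + 1)) (q : Σ i : Fin (d + 1), Fin (a i)),
        G.Adj (f (.inr q)) (f (.inl i)) ↔ q.1 = i := by
      intro i q
      rw [(hatt _ (hne q)).2, hattq q, Fin.ext_iff]
      exact ⟨fun h => (hinj i (hle i) q.1 (hle q.1) h).symm, fun h => congrArg p h.symm⟩
    rintro (i | q) (j | s)
    · exact (hpath i (hle i) j (hle j)).trans SimpleGraph.pathGraph_adj.symm
    · rw [SimpleGraph.adj_comm]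
      exact hin i s
    · exact hin j q
    · have h1 : (pendentPath d a).Adj (.inr q) (.inr s) ↔ False := Iff.rfl
      rw [h1, iff_false, (hatt _ (hne q)).2]
      exact fun h => hne s _ (hatt _ (hne q)).1 h.symm
  exact ⟨(SimpleGraph.Iso.symm ⟨Equiv.ofBijective f hbij, fun {u v} => hadj u v⟩)⟩

/-- If all leaves hang in the first half, a leaf at position i + 1 has eccentricity d - i, shared
only with leaves at the same position and the path vertices i and d - i. So the counts are forced; a
leaf at position 0 would have eccentricity d + 1. -/
theorem nonempty_iso_of_eccCount {D : ℕ} (hD : 2 * D ≤ d) (p : ℕ → V) (att : V → ℕ)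
    (hinj : ∀ i ≤ d, ∀ j ≤ d, p i = p j → i = j)
    (hpath : ∀ i ≤ d, ∀ j ≤ d, (G.Adj (p i) (p j) ↔ i + 1 = j ∨ j + 1 = i))
    (hatt : ∀ w, (∀ i ≤ d, p i ≠ w) → ∀ v, G.Adj w v ↔ v = p (att w))
    (hattD : ∀ w, (∀ i ≤ d, p i ≠ w) → att w ≤ D)
    (hle : ∀ w, vertexEcc G w ≤ d)
    (hp : ∀ i ≤ d, vertexEcc G (p i) = max i (d - i))
    (hecc : ∀ w, (∀ i ≤ d, p i ≠ w) → vertexEcc G w = max (att w) (d - att w) + 1)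
    (h0 : a 0 = 0) (ha : ∀ i < D, a (i + 1) = eccCount G (d - i) - 2)
    (ha' : ∀ i, D < i → a i = 0) : Nonempty (G ≃g pendentPath d a) := by
  classical
  refine nonempty_iso_of_spine p att hinj hpath
    (fun w hw => ⟨(hattD w hw).trans (by omega), hatt w hw⟩) fun i hi => ?_
  rcases Nat.eq_zero_or_pos i with rfl | hpos
  · rw [h0, Nat.card_eq_zero]
    refine Or.inl ⟨fun ⟨w, hw, hw0⟩ => ?_⟩
    have h1 := hle w
    have h2 := hecc w hw
    omega
  rcases Nat.lt_or_ge D i with hiD | hiD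
  · rw [ha' i hiD, Nat.card_eq_zero]
    refine Or.inl ⟨fun ⟨w, hw, hw0⟩ => ?_⟩
    have h1 := hattD w hw
    omega
  obtain ⟨i, rfl⟩ : ∃ j, i = j + 1 := ⟨i - 1, by omega⟩
  rw [ha i (by omega), eccCount]
  have h1 : Finset.univ.filter (fun w => vertexEcc G w = d - i) =
      insert (p i) (insert (p (d - i))
        (Finset.univ.filter fun w => (∀ j ≤ d, p j ≠ w) ∧ att w = i + 1)) := by
    ext w
    simp only [Finset.mem_filter, Finset.mem_univ, true_and, Finset.mem_insert]
    by_cases hw : ∃ j ≤ d, p j = w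
    · obtain ⟨j, hj, rfl⟩ := hw
      rw [hp j hj]
      constructor
      · intro h
        rcases (by omega : j = i ∨ j = d - i) with rfl | rfl
        · exact Or.inl rfl
        · exact Or.inr (Or.inl rfl)
      · rintro (h | h | h)
        · have := hinj j hj i (by omega) h
          omega
        · have := hinj j hj (d - i) (by omega) h
          omega
        · exact absurd rfl (h.1 j hj)
    · push Not at hw
      have h2 := hattD w hw
      have h3 := hecc w hw
      constructor
      · intro h
        exact Or.inr (Or.inr ⟨hw, by omega⟩)
      · rintro (h | h | h)
        · exact absurd h.symm (hw i (by omega))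
        · exact absurd h.symm (hw (d - i) (by omega))
        · omega
  rw [h1, Finset.card_insert_of_notMem, Finset.card_insert_of_notMem, Nat.card_eq_fintype_card,
    Fintype.card_subtype]
  · omega
  · simp only [Finset.mem_filter, Finset.mem_univ, true_and, not_and]
    exact fun h => absurd rfl (h (d - i) (by omega))
  · simp only [Finset.mem_insert, Finset.mem_filter, Finset.mem_univ, true_and, not_or, not_and]
    refine ⟨fun h => ?_, fun h => absurd rfl (h i (by omega))⟩
    have := hinj i (by omega) (d - i) (by omega) h
    omega

end Spine

end PendentPath

/-! ### The case of equality -/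

/-- The path from `x` through the root to `y`, at distances `D` and `r` from the root. -/
def spine {V : Type*} (par : V → V) (x y : V) (D r : ℕ) (j : ℕ) : V :=
  if j ≤ D then par^[j] x else par^[D + r - j] y

namespace IsCentralRooting

variable {V : Type*} [Fintype V] [DecidableEq V] {G : SimpleGraph V} {c c' x y : V} {par : V → V}
  {D r : ℕ}

theorem spine_root (h : IsCentralRooting G c c' x y par D r) : spine par x y D r D = c := by
  rw [spine, if_pos le_rfl, h.iterate_x_eq_root]

theorem spine_child (h : IsCentralRooting G c c' x y par D r) :
    spine par x y D r (D + 1) = c' := by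
  rw [spine, if_neg (by omega), ← h.iterate_y_eq_child]
  congr 1
  omega

theorem vertexEcc_spine (h : IsCentralRooting G c c' x y par D r) {j : ℕ} (hj : j ≤ D + r) :
    vertexEcc G (spine par x y D r j) = max j (D + r - j) := by
  have hD := h.D_le
  have hr := h.r_le
  rw [spine]
  split_ifs with hjD
  · have := h.vertexEcc_iterate (w := x) (i := j) (by rw [h.vertexEcc_x]; omega)
    rw [h.vertexEcc_x] at this
    omega
  · have := h.vertexEcc_iterate (w := y) (i := D + r - j) (by rw [h.vertexEcc_y]; omega)
    rw [h.vertexEcc_y] at this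
    omega

theorem isDesc_spine_iff (h : IsCentralRooting G c c' x y par D r) (j : ℕ) (hj : j ≤ D + r) :
    IsDesc par (spine par x y D r j) c' ↔ D < j := by
  rw [spine]
  split_ifs with hjD
  · exact ⟨fun hd => absurd (IsDesc.trans ⟨j, rfl⟩ hd) h.not_desc_x, fun hlt => by omega⟩
  · refine ⟨fun _ => by omega, fun _ => ?_⟩
    rw [← h.iterate_y_eq_child]
    exact ⟨r - 1 - (D + r - j), by
      rw [← Function.iterate_add_apply, Nat.sub_add_cancel (by omega)]⟩

theorem spine_injOn (h : IsCentralRooting G c c' x y par D r) :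
    ∀ i ≤ D + r, ∀ j ≤ D + r, spine par x y D r i = spine par x y D r j → i = j := by
  intro i hi j hj e
  have hD := h.D_le
  have hr := h.r_le
  have h1 := h.vertexEcc_spine hi
  have h2 := h.vertexEcc_spine hj
  have h3 := h.isDesc_spine_iff i hi
  have h4 := h.isDesc_spine_iff j hj
  rw [e] at h1 h3
  have h5 := h3.symm.trans h4
  omega

theorem par_spine (h : IsCentralRooting G c c' x y par D r) {j : ℕ} (hj : j ≤ D + r) :
    par (spine par x y D r j) =
      spine par x y D r (if j < D then j + 1 else if j = D then D else j - 1) := by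
  split_ifs with h1 h2
  · rw [spine, if_pos h1.le, spine, if_pos (by omega), Function.iterate_succ_apply']
  · rw [h2, h.spine_root, h.rooting.par_root]
  · by_cases h3 : j = D + 1
    · rw [h3, h.spine_child, h.par_child, Nat.add_sub_cancel, h.spine_root]
    · rw [spine, if_neg (by omega), spine, if_neg (by omega), ← Function.iterate_succ_apply' par]
      congr 1
      omega

theorem spine_adj_iff (h : IsCentralRooting G c c' x y par D r) :
    ∀ i ≤ D + r, ∀ j ≤ D + r, (G.Adj (spine par x y D r i) (spine par x y D r j) ↔
      i + 1 = j ∨ j + 1 = i) := by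
  have hone := h.one_le_r
  have aux : ∀ i ≤ D + r, ∀ j ≤ D + r, (spine par x y D r i ≠ c ∧
      par (spine par x y D r i) = spine par x y D r j) ↔
      (i < D ∧ i + 1 = j ∨ D < i ∧ j + 1 = i) := by
    intro i hi j hj
    have h1 : spine par x y D r i ≠ c ↔ i ≠ D := by
      rw [not_iff_not]
      constructor
      · intro e
        exact h.spine_injOn i hi D (by omega) (e.trans h.spine_root.symm)
      · rintro rfl
        exact h.spine_root
    rw [h1, h.par_spine hi]
    constructor
    · rintro ⟨h2, h3⟩
      have := h.spine_injOn _ (by split_ifs <;> omega) j hj h3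
      split_ifs at this <;> omega
    · intro h2
      refine ⟨by omega, ?_⟩
      congr 1
      split_ifs <;> omega
  intro i hi j hj
  rw [h.rooting.adj_iff, aux i hi j hj, aux j hj i hi]
  omega

theorem lt_vertexEcc_of_not_spine (h : IsCentralRooting G c c' x y par D r) {w : V}
    (hw : ∀ i ≤ D + r, spine par x y D r i ≠ w) : r < vertexEcc G w := by
  have hone := h.one_le_r
  refine lt_of_le_of_ne (h.le_vertexEcc w) fun e => ?_
  rcases (h.vertexEcc_eq_r_iff w).1 e.symm with rfl | ⟨-, rfl⟩
  · exact hw D (by omega) h.spine_root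
  · exact hw (D + 1) (by omega) h.spine_child

/-- The vertices off the spine are leaves, and one side of the centre carries no such leaves. -/
def IsTight {V : Type*} [Fintype V] (c' x y : V) (par : V → V) (D r : ℕ) :
    Prop :=
  (∀ w, (∀ i ≤ D + r, spine par x y D r i ≠ w) → (descendants par w).card = 1) ∧
    ((descendants par c').card = r ∨
      ∀ w, (∀ i ≤ D + r, spine par x y D r i ≠ w) → ∀ j, j < r →
        par w ≠ spine par x y D r j)

/-- A descendant set no larger than the piece of the spine inside it contains nothing else. The bare
side is decided at the central edge if D < r, and among the two spine neighbours of c, at level D -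
1, if D = r. -/
theorem isTight (h : IsCentralRooting G c c' x y par D r) (hD0 : 1 ≤ D)
    (h1 : ∀ i < D, ((descendants par (par^[i] x)).card = i + 1 ∨
      (descendants par (par^[i] y)).card = i + 1) ∧ ∀ w, vertexEcc G w = D + r - i →
      w ≠ par^[i] x → w ≠ par^[i] y → (descendants par w).card = 1)
    (h2 : D < r → (descendants par c').card = r ∨ ((descendants par c')ᶜ).card = D + 1) :
    IsTight c' x y par D r := by
  have hD := h.D_le
  have hr := h.r_le
  have hx : ∀ i ≤ D, spine par x y D r i = par^[i] x := fun i hi => by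
    rw [spine, if_pos hi]
  have hy : ∀ i < r, spine par x y D r (D + r - i) = par^[i] y := fun i hi => by
    rw [spine, if_neg (by omega)]
    congr 1
    omega
  constructor
  · intro w hw
    have h3 := h.lt_vertexEcc_of_not_spine hw
    have h4 := h.vertexEcc_le w
    refine (h1 (D + r - vertexEcc G w) (by omega)).2 w (by omega) ?_ ?_
    · rw [← hx _ (by omega)]
      exact (hw _ (by omega)).symm
    · rw [← hy _ (by omega)]
      exact (hw _ (by omega)).symm
  · rcases hD.lt_or_eq with hlt | heq
    · refine (h2 hlt).imp_right fun h3 w hw j hj e => ?_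
      have h4 := Finset.eq_of_subset_of_card_le h.iterates_x_subset
        (by rw [h3, h.card_iterates (by rw [h.vertexEcc_x]; omega)])
      have h5 : w ∈ (descendants par c')ᶜ := by
        rw [Finset.mem_compl, mem_descendants]
        intro hd
        have hne : w ≠ c' := by
          rintro rfl
          exact hw (D + 1) (by omega) h.spine_child
        have h6 := hd.par_of_ne hne
        rw [e, h.isDesc_spine_iff j (by omega)] at h6
        omega
      rw [← h4] at h5
      obtain ⟨i, hi, rfl⟩ := Finset.mem_image.1 h5
      rw [Finset.mem_range] at hi
      exact hw i (by omega) (hx i (by omega))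
    · have h3 := (h1 (D - 1) (by omega)).1
      rw [Nat.sub_add_cancel hD0] at h3
      rcases h3 with h3 | h3
      · refine Or.inr fun w hw j hj e => ?_
        have h4 := Finset.eq_of_subset_of_card_le (iterates_subset_descendants par x (D - 1))
          (by rw [h3, h.card_iterates (by rw [h.vertexEcc_x]; omega)]; omega)
        have h5 : w ∈ descendants par (par^[D - 1] x) := by
          rw [mem_descendants]
          refine IsDesc.of_par ?_
          rw [e, hx j (by omega)]
          exact ⟨D - 1 - j, by rw [← Function.iterate_add_apply, Nat.sub_add_cancel (by omega)]⟩
        rw [← h4] at h5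
        obtain ⟨i, hi, rfl⟩ := Finset.mem_image.1 h5
        rw [Finset.mem_range] at hi
        exact hw i (by omega) (hx i (by omega))
      · left
        rw [← h.iterate_y_eq_child, ← heq, h3]

/-- Off-spine vertices are leaves, and their parents, not being leaves, lie on the spine. If the
half of y is bare, the spine serves as the path; otherwise it is reversed, and leaves at positions
at least r move to positions at most D. -/
theorem nonempty_iso_of_isTight (h : IsCentralRooting G c c' x y par D r)
    (ht : IsTight c' x y par D r) {a : ℕ → ℕ} (h0 : a 0 = 0)
    (ha : ∀ i < D, a (i + 1) = eccCount G (D + r - i) - 2) (ha' : ∀ i, D < i → a i = 0) :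
    Nonempty (G ≃g pendentPath (D + r) a) := by
  have hD := h.D_le
  have hr := h.r_le
  have hone := h.one_le_r
  obtain ⟨hleaf, hside⟩ := ht
  have hadj : ∀ w, (∀ i ≤ D + r, spine par x y D r i ≠ w) → ∀ v, G.Adj w v ↔ v = par w := by
    intro w hw v
    have hwc : w ≠ c := by
      rintro rfl
      exact hw D (by omega) h.spine_root
    rw [h.rooting.adj_iff]
    constructor
    · rintro (⟨-, e⟩ | ⟨hv, e⟩)
      · exact e.symm
      · obtain ⟨z, hz⟩ := Finset.card_eq_one.1 (hleaf w hw)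
        have h1 : v ∈ descendants par w := mem_descendants.2 ⟨1, e⟩
        have h2 : w ∈ descendants par w := mem_descendants.2 (IsDesc.refl w)
        rw [hz, Finset.mem_singleton] at h1 h2
        exact absurd (e.trans (h2.trans h1.symm)) (h.rooting.par_ne hv)
    · rintro rfl
      exact Or.inl ⟨hwc, rfl⟩
  have hpar : ∀ w, ∃ j, (∀ i ≤ D + r, spine par x y D r i ≠ w) →
      j ≤ D + r ∧ par w = spine par x y D r j := by
    intro w
    by_cases hw : ∀ i ≤ D + r, spine par x y D r i ≠ w
    · by_cases hpw : ∀ i ≤ D + r, spine par x y D r i ≠ par w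
      · exfalso
        obtain ⟨z, hz⟩ := Finset.card_eq_one.1 (hleaf _ hpw)
        have h1 : w ∈ descendants par (par w) := mem_descendants.2 ⟨1, rfl⟩
        have h2 : par w ∈ descendants par (par w) := mem_descendants.2 (IsDesc.refl _)
        rw [hz, Finset.mem_singleton] at h1 h2
        have hwc : w ≠ c := by
          rintro rfl
          exact hw D (by omega) h.spine_root
        exact h.rooting.par_ne hwc (h2.trans h1.symm)
      · push Not at hpw
        obtain ⟨j, hj, e⟩ := hpw
        exact ⟨j, fun _ => ⟨hj, e.symm⟩⟩
    -- The value 0 on spine vertices is a dummy.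
    · exact ⟨0, fun h' => absurd h' hw⟩
  choose att hatt using hpar
  have hecc : ∀ w, (∀ i ≤ D + r, spine par x y D r i ≠ w) →
      vertexEcc G w = max (att w) (D + r - att w) + 1 := by
    intro w hw
    rw [← h.vertexEcc_par (h.lt_vertexEcc_of_not_spine hw), (hatt w hw).2,
      h.vertexEcc_spine (hatt w hw).1]
  rcases hside with hside | hside
  · refine PendentPath.nonempty_iso_of_eccCount (D := D) (by omega) (spine par x y D r) att
      h.spine_injOn h.spine_adj_iff (fun w hw v => ?_) (fun w hw => ?_)
      h.vertexEcc_le (fun i hi => h.vertexEcc_spine hi) hecc h0 ha ha'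
    · rw [hadj w hw, (hatt w hw).2]
    · by_contra hlt
      have h1 : IsDesc par (par w) c' := by
        rw [(hatt w hw).2, h.isDesc_spine_iff _ (hatt w hw).1]
        omega
      have h2 := Finset.eq_of_subset_of_card_le (iterates_subset_descendants par y (r - 1))
        (by rw [h.iterate_y_eq_child, hside,
          h.card_iterates (by rw [h.vertexEcc_y]; omega)]; omega)
      rw [h.iterate_y_eq_child] at h2
      have h3 : w ∈ descendants par c' := mem_descendants.2 h1.of_par
      rw [← h2] at h3
      obtain ⟨i, hi, rfl⟩ := Finset.mem_image.1 h3
      rw [Finset.mem_range] at hi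
      refine hw (D + r - i) (by omega) ?_
      rw [spine, if_neg (by omega)]
      congr 1
      omega
  · have hrev : ∀ w, (∀ i ≤ D + r, spine par x y D r (D + r - i) ≠ w) →
        ∀ i ≤ D + r, spine par x y D r i ≠ w := by
      intro w hw i hi
      have := hw (D + r - i) (by omega)
      rwa [Nat.sub_sub_self hi] at this
    refine PendentPath.nonempty_iso_of_eccCount (D := D) (by omega)
      (fun i => spine par x y D r (D + r - i)) (fun w => D + r - att w)
      (fun i hi j hj e => ?_) (fun i hi j hj => ?_) (fun w hw v => ?_) (fun w hw => ?_)
      h.vertexEcc_le (fun i hi => ?_) (fun w hw => ?_) h0 ha ha'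
    · have := h.spine_injOn _ (by omega) _ (by omega) e
      omega
    · rw [h.spine_adj_iff _ (by omega) _ (by omega)]
      omega
    · have hw' := hrev w hw
      rw [hadj w hw', (hatt w hw').2, Nat.sub_sub_self (hatt w hw').1]
    · have hw' := hrev w hw
      by_contra hlt
      exact hside w hw' (att w) (by omega) (hatt w hw').2
    · rw [h.vertexEcc_spine (by omega)]
      omega
    · have hw' := hrev w hw
      have := (hatt w hw').1
      rw [hecc w hw']
      omega

end IsCentralRooting

/-! ### Reading the parameters off the eccentric sequence -/

section Sequence

variable {V : Type*} [Fintype V] {G : SimpleGraph V}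

theorem count_eccentricSequence (G : SimpleGraph V) (e : ℕ) :
    (eccentricSequence G).count e = eccCount G e := by
  classical
  rw [eccentricSequence, ← Multiset.coe_count, Multiset.sort_eq, Multiset.count_map, eccCount,
    Finset.card_def, Finset.filter_val]
  congr 2
  ext v
  exact eq_comm

theorem length_eccentricSequence (G : SimpleGraph V) :
    (eccentricSequence G).length = Fintype.card V := by
  rw [eccentricSequence, Multiset.length_sort, Multiset.card_map]
  rfl

theorem mem_eccentricSequence {G : SimpleGraph V} {e : ℕ} :
    e ∈ eccentricSequence G ↔ ∃ v, vertexEcc G v = e := by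
  rw [eccentricSequence, Multiset.mem_sort, Multiset.mem_map]
  simp

theorem eccentricSequence_eq_of_eccCount {W : Type*} [Fintype W] {H : SimpleGraph W}
    (h : ∀ e, eccCount G e = eccCount H e) : eccentricSequence G = eccentricSequence H := by
  have h1 : (eccentricSequence G).Perm (eccentricSequence H) :=
    List.perm_iff_count.2 fun e => by
      rw [count_eccentricSequence, count_eccentricSequence, h]
  exact h1.eq_of_pairwise' (Multiset.pairwise_sort _ _) (Multiset.pairwise_sort _ _)

theorem SimpleGraph.Iso.vertexEcc_eq {W : Type*} {H : SimpleGraph W} (φ : G ≃g H)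
    (hG : G.Connected) (v : V) : vertexEcc H (φ v) = vertexEcc G v := by
  have hH : H.Connected := φ.connected_iff.1 hG
  have h1 : ∀ u w, H.dist (φ u) (φ w) ≤ G.dist u w := fun u w => by
    obtain ⟨p, hp⟩ := hG.exists_walk_length_eq_dist u w
    rw [← hp, ← p.length_map φ.toHom]
    exact SimpleGraph.dist_le _
  have h2 : ∀ u w, G.dist u w ≤ H.dist (φ u) (φ w) := fun u w => by
    obtain ⟨p, hp⟩ := hH.exists_walk_length_eq_dist (φ u) (φ w)
    have h3 := SimpleGraph.dist_le (p.map φ.symm.toHom)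
    rw [SimpleGraph.Walk.length_map, hp] at h3
    simpa using h3
  have h4 : H.eccent (φ v) = G.eccent v := by
    simp only [SimpleGraph.eccent_def]
    refine (φ.toEquiv.iSup_congr fun w => ?_).symm
    rw [← (hG v w).coe_dist_eq_edist, ← (hH _ _).coe_dist_eq_edist]
    exact_mod_cast le_antisymm (h1 v w) (h2 v w)
  rw [vertexEcc, vertexEcc, h4]

theorem SimpleGraph.Iso.eccentricSequence_eq {W : Type*} [Fintype W] {H : SimpleGraph W}
    (φ : G ≃g H) (hG : G.Connected) : eccentricSequence H = eccentricSequence G := by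
  refine (eccentricSequence_eq_of_eccCount fun e => ?_).symm
  classical
  rw [eccCount, eccCount, ← Fintype.card_subtype, ← Fintype.card_subtype]
  exact Fintype.card_congr (φ.toEquiv.subtypeEquiv fun v => by
    rw [← φ.vertexEcc_eq hG v]
    rfl)

theorem isTreeEccentricSequence (hG : G.IsTree) (hpos : ∀ v, 0 < vertexEcc G v) :
    IsTreeEccentricSequence (eccentricSequence G) := by
  refine ⟨fun a ha => ?_, Fintype.card V, G.map (Fintype.equivFin V).toEmbedding, ?_, ?_⟩
  · obtain ⟨v, rfl⟩ := mem_eccentricSequence.1 ha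
    exact hpos v
  · exact (SimpleGraph.Iso.map (Fintype.equivFin V) G).isTree_iff.1 hG
  · exact (SimpleGraph.Iso.map (Fintype.equivFin V) G).eccentricSequence_eq hG.connected

theorem Finset.sort_Icc_nat (a b : ℕ) :
    (Finset.Icc a b).sort (· ≤ ·) = List.range' a (b + 1 - a) := by
  have h1 : ((Finset.Icc a b).sort (· ≤ ·)).Perm (List.range' a (b + 1 - a)) := by
    rw [← Multiset.coe_eq_coe, Finset.sort_eq]
    rfl
  exact h1.eq_of_pairwise' (Finset.pairwise_sort _ _)
    ((List.sortedLT_range' a _ one_ne_zero).pairwise.imp fun h => le_of_lt h)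

end Sequence

namespace IsCentralRooting

variable {V : Type*} [Fintype V] [DecidableEq V] {G : SimpleGraph V} {c c' x y : V} {par : V → V}
  {D r : ℕ}

/-- The ancestors of x already take all values from r to D + r. Hence l = D + 1, b_j = r + j - 1 and
d = D + r. -/
theorem toFinset_eccentricSequence (h : IsCentralRooting G c c' x y par D r) :
    (eccentricSequence G).toFinset = Finset.Icc r (D + r) := by
  ext e
  rw [List.mem_toFinset, mem_eccentricSequence, Finset.mem_Icc]
  constructor
  · rintro ⟨v, rfl⟩
    exact ⟨h.le_vertexEcc v, h.vertexEcc_le v⟩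
  · rintro ⟨h1, h2⟩
    refine ⟨par^[D + r - e] x, ?_⟩
    have := h.vertexEcc_iterate (w := x) (i := D + r - e) (by rw [h.vertexEcc_x]; omega)
    rw [h.vertexEcc_x] at this
    omega

theorem seqNumValues_eq (h : IsCentralRooting G c c' x y par D r) :
    seqNumValues (eccentricSequence G) = D + 1 := by
  rw [seqNumValues, h.toFinset_eccentricSequence, Nat.card_Icc]
  omega

theorem seqValue_eq (h : IsCentralRooting G c c' x y par D r) {j : ℕ} (hj : j ≤ D) :
    seqValue (eccentricSequence G) (j + 1) = r + j := by
  rw [seqValue, h.toFinset_eccentricSequence, Finset.sort_Icc_nat, Nat.add_sub_cancel,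
    List.getD_eq_getElem _ _ (by rw [List.length_range']; omega), List.getElem_range']
  omega

theorem seqRadius_eq (h : IsCentralRooting G c c' x y par D r) :
    seqRadius (eccentricSequence G) = r :=
  h.seqValue_eq (Nat.zero_le D)

theorem seqDiam_eq (h : IsCentralRooting G c c' x y par D r) :
    seqDiam (eccentricSequence G) = D + r := by
  rw [seqDiam, h.seqNumValues_eq, h.seqValue_eq le_rfl, add_comm]

theorem seqMult_eq (h : IsCentralRooting G c c' x y par D r) {j : ℕ} (hj : j ≤ D) :
    seqMult (eccentricSequence G) (j + 1) = eccCount G (r + j) := by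
  rw [seqMult, h.seqValue_eq hj, count_eccentricSequence]

theorem pathLength_eq (h : IsCentralRooting G c c' x y par D r) :
    seqRadius (eccentricSequence G) + seqNumValues (eccentricSequence G) - 1 = D + r := by
  rw [h.seqRadius_eq, h.seqNumValues_eq]
  omega

theorem standardPendents_succ (h : IsCentralRooting G c c' x y par D r) {i : ℕ} (hi : i < D) :
    standardPendents (seqNumValues (eccentricSequence G)) (seqMult (eccentricSequence G)) (i + 1) =
      eccCount G (D + r - i) - 2 := by
  rw [standardPendents, h.seqNumValues_eq, if_pos (by omega),
    show D + 1 + 1 - (i + 1) = D - i + 1 by omega, h.seqMult_eq (by omega),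
    show r + (D - i) = D + r - i by omega]

theorem standardPendents_zero (l : ℕ) (m : ℕ → ℕ) : standardPendents l m 0 = 0 := by
  rw [standardPendents, if_neg (by omega)]

theorem standardPendents_of_lt (h : IsCentralRooting G c c' x y par D r) {i : ℕ} (hi : D < i) :
    standardPendents (seqNumValues (eccentricSequence G)) (seqMult (eccentricSequence G)) i = 0 := by
  rw [standardPendents, h.seqNumValues_eq, if_neg (by omega)]

/-- Ensures that the truncated m_j - 2 is a true difference. -/
theorem two_le_eccCount (h : IsCentralRooting G c c' x y par D r) {i : ℕ} (hi : i < D) :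
    2 ≤ eccCount G (D + r - i) := by
  rw [← level_card, ← Finset.card_pair (h.iterate_ne hi i)]
  refine Finset.card_le_card fun w hw => ?_
  rcases Finset.mem_insert.1 hw with rfl | hw
  · exact h.mem_level hi h.vertexEcc_x
  · rw [Finset.mem_singleton.1 hw]
    exact h.mem_level hi h.vertexEcc_y

theorem card_eq (h : IsCentralRooting G c c' x y par D r) :
    Fintype.card V = ∑ i ∈ Finset.range D, eccCount G (D + r - i) + (r - D + 1) := by
  have h1 := h.sum_erase_root fun _ => 1
  simp only [Finset.sum_const, smul_eq_mul, mul_one, level_card] at h1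
  rw [Finset.card_erase_of_mem (Finset.mem_univ c), Finset.card_univ] at h1
  have h2 : 0 < Fintype.card V := Fintype.card_pos_iff.2 ⟨c⟩
  have hD := h.D_le
  have hr := h.r_le
  split_ifs at h1 <;> omega

theorem card_standardTree (h : IsCentralRooting G c c' x y par D r) :
    Fintype.card (PendentPathVertex
      (seqRadius (eccentricSequence G) + seqNumValues (eccentricSequence G) - 1)
      (standardPendents (seqNumValues (eccentricSequence G)) (seqMult (eccentricSequence G)))) =
      Fintype.card V := by
  rw [PendentPath.card_vertex, h.pathLength_eq]
  exact PendentPath.sum_pendents h.D_le (standardPendents_zero _ _)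
    (fun i hi => h.standardPendents_succ hi) (fun i hi => h.standardPendents_of_lt hi)
    (fun i hi => h.two_le_eccCount hi) h.card_eq

theorem steinerWiener_extremalTree_add (h : IsCentralRooting G c c' x y par D r) {k : ℕ}
    (hk : 1 ≤ k) : steinerWiener k (extremalTree (eccentricSequence G)) +
      levelBound (Fintype.card V) k (fun i => eccCount G (D + r - i)) D r =
      (Fintype.card V - 1) * (Fintype.card V).choose k := by
  have h1 : PendentPath.edgeSum (Fintype.card V) k
      (seqRadius (eccentricSequence G) + seqNumValues (eccentricSequence G) - 1)
      (standardPendents (seqNumValues (eccentricSequence G)) (seqMult (eccentricSequence G))) =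
      levelBound (Fintype.card V) k (fun i => eccCount G (D + r - i)) D r := by
    rw [h.pathLength_eq]
    exact PendentPath.edgeSum_eq_levelBound k h.D_le h.r_le (standardPendents_zero _ _)
      (fun i hi => h.standardPendents_succ hi) (fun i hi => h.standardPendents_of_lt hi)
      (fun i hi => h.two_le_eccCount hi) h.card_eq
  rw [← PendentPath.steinerWiener_add hk h.card_standardTree, ← h1]
  rfl

theorem steinerWiener_extremalTree_le (h : IsCentralRooting G c c' x y par D r) {k : ℕ}
    (hk : 1 ≤ k) : steinerWiener k (extremalTree (eccentricSequence G)) ≤ steinerWiener k G := by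
  have h1 := h.steinerWiener_extremalTree_add hk
  have h2 := h.rooting.steinerWiener_add hk
  have h3 := h.sum_le_levelBound k
  omega

theorem nonempty_iso_extremalTree (h : IsCentralRooting G c c' x y par D r) {k : ℕ}
    (hk : 2 ≤ k) (hkr : k + r ≤ Fintype.card V) (hn : 2 < Fintype.card V)
    (heq : steinerWiener k G = steinerWiener k (extremalTree (eccentricSequence G))) :
    Nonempty (G ≃g extremalTree (eccentricSequence G)) := by
  have h1 := h.steinerWiener_extremalTree_add (k := k) (by omega)
  have h2 := h.rooting.steinerWiener_add (k := k) (by omega)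
  have h3 := h.tight_of_sum_eq hk hkr (by omega)
  -- For D = 0 the tree has r + 1 ≤ 2 vertices.
  have hD : 1 ≤ D := by
    by_contra h0
    obtain rfl : D = 0 := by omega
    have h4 := h.card_eq
    have h5 := h.r_le
    rw [Finset.sum_range_zero] at h4
    omega
  have h4 := h.nonempty_iso_of_isTight (h.isTight hD h3.1 h3.2)
    (a := standardPendents (seqNumValues (eccentricSequence G)) (seqMult (eccentricSequence G)))
    (standardPendents_zero _ _)
    (fun i hi => h.standardPendents_succ hi) (fun i hi => h.standardPendents_of_lt hi)
  rw [← h.pathLength_eq] at h4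
  exact h4

end IsCentralRooting

theorem SimpleGraph.IsTree.exists_isCentralRooting_of_nontrivial {V : Type*} [Fintype V]
    {G : SimpleGraph V} (hG : G.IsTree) (hV : 1 < Fintype.card V) :
    ∃ c c' x y par D r, IsCentralRooting G c c' x y par D r := by
  have hne : Nontrivial V := Fintype.one_lt_card_iff_nontrivial.1 hV
  have htop : G.ediam ≠ ⊤ := SimpleGraph.connected_iff_ediam_ne_top.1 hG.connected
  have hpos : G.diam ≠ 0 := SimpleGraph.connected_iff_diam_ne_zero.1 hG.connected
  obtain ⟨x, y, hxy⟩ := G.exists_dist_eq_diam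
  obtain ⟨c, c', par, h⟩ := hG.exists_isCentralRooting (x := x) (y := y) (D := G.diam / 2)
    (r := G.diam - G.diam / 2) (by omega) (by omega) (by omega) (by omega) fun u v => by
      have := SimpleGraph.dist_le_diam htop (u := u) (v := v)
      omega
  exact ⟨c, c', x, y, par, _, _, h⟩

theorem Nat.ceil_half (d : ℕ) : ⌈(d : ℚ) / 2⌉₊ = (d + 1) / 2 := by
  apply le_antisymm
  · rw [Nat.ceil_le, div_le_iff₀ (by norm_num)]
    have : d ≤ (d + 1) / 2 * 2 := by omega
    exact_mod_cast this
  · have h1 := Nat.le_ceil ((d : ℚ) / 2)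
    rw [div_le_iff₀ (by norm_num)] at h1
    have h2 : d ≤ ⌈(d : ℚ) / 2⌉₊ * 2 := by exact_mod_cast h1
    omega

/-! ### The threshold for k -/

namespace PendentPath

variable {d : ℕ} {a : ℕ → ℕ}

theorem exists_isCentralRooting (hd : 1 ≤ d) (h0 : a 0 = 0) (ha : a d = 0) :
    ∃ c c' par, IsCentralRooting (pendentPath d a) c c' (.inl 0) (.inl (Fin.last d)) par
      (d / 2) (d - d / 2) := by
  have hle : ∀ u v, (pendentPath d a).dist u v ≤ d / 2 + (d - d / 2) := fun u v => by
    have h1 := dist_le_max h0 ha u v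
    have h2 := depth_le_pos h0 u
    have h3 := depth_le_sub_pos ha u
    have h4 := pos_le u
    omega
  refine (isTree d a).exists_isCentralRooting (by omega) (by omega) (by omega)
    (le_antisymm (hle _ _) ?_) hle
  have h1 := le_dist_last (d := d) (a := a) (.inl 0)
  simp only [pos, depth, Fin.val_zero] at h1
  omega

theorem sum_ite_eq_position {X N : ℕ} (hX : X ≤ d) (P : ℕ → Prop) [DecidablePred P] :
    ∑ i ∈ Finset.range (d + 1), (if P i then (if i = X then N else 0) else 0) =
      if P X then N else 0 := by
  rw [Finset.sum_eq_single X]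
  · simp
  · intro i _ hi
    simp [hi]
  · intro h
    exact absurd (Finset.mem_range.2 (Nat.lt_succ_of_le hX)) h

theorem card_path_vertices {i : ℕ} (hi : 2 * i < d) :
    ∑ j ∈ Finset.range (d + 1), (if max j (d - j) = d - i then 1 else 0) = 2 := by
  rw [← Finset.card_filter, Finset.card_eq_two]
  refine ⟨i, d - i, by omega, ?_⟩
  ext j
  simp only [Finset.mem_filter, Finset.mem_range, Finset.mem_insert, Finset.mem_singleton]
  omega

theorem eccCount_single {X N : ℕ} (hX : 1 ≤ X) (hXd : X < d) (e : ℕ) :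
    eccCount (pendentPath d fun i => if i = X then N else 0) e =
      ∑ i ∈ Finset.range (d + 1), (if max i (d - i) = e then 1 else 0) +
        if max X (d - X) + 1 = e then N else 0 := by
  rw [eccCount_eq (a := fun i => if i = X then N else 0) (if_neg (by omega)) (if_neg (by omega)),
    Finset.sum_add_distrib,
    sum_ite_eq_position hXd.le (fun i => max i (d - i) + 1 = e)]

theorem eccCount_double {X Y N M : ℕ} (hX : 1 ≤ X) (hXY : X < Y) (hYd : Y < d) (e : ℕ) :
    eccCount (pendentPath d fun i => if i = X then N else if i = Y then M else 0) e =
      ∑ i ∈ Finset.range (d + 1), (if max i (d - i) = e then 1 else 0) +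
        ((if max X (d - X) + 1 = e then N else 0) + if max Y (d - Y) + 1 = e then M else 0) := by
  rw [eccCount_eq (a := fun i => if i = X then N else if i = Y then M else 0)
    (by rw [if_neg (by omega), if_neg (by omega)]) (by rw [if_neg (by omega), if_neg (by omega)]), Finset.sum_add_distrib]
  congr 1
  rw [← sum_ite_eq_position (d := d) (by omega) (fun i => max i (d - i) + 1 = e),
    ← sum_ite_eq_position (d := d) (X := Y) (by omega) (fun i => max i (d - i) + 1 = e),
    ← Finset.sum_add_distrib]
  refine Finset.sum_congr rfl fun i _ => ?_
  by_cases hX' : i = X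
  · have hY' : i ≠ Y := by omega
    split_ifs <;> simp_all
  · split_ifs <;> simp_all

theorem sum_single (X N i : ℕ) :
    ∑ j ∈ Finset.range (i + 1), ((if j = X then N else 0) + 1) =
      (if X ≤ i then N else 0) + (i + 1) := by
  rw [Finset.sum_add_distrib, Finset.sum_ite_eq', Finset.sum_const, Finset.card_range]
  simp

theorem sum_double {X Y : ℕ} (hXY : X < Y) (N M i : ℕ) :
    ∑ j ∈ Finset.range (i + 1), ((if j = X then N else if j = Y then M else 0) + 1) =
      (if X ≤ i then N else 0) + (if Y ≤ i then M else 0) + (i + 1) := by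
  have h1 : ∀ j, (if j = X then N else if j = Y then M else 0) =
      (if j = X then N else 0) + if j = Y then M else 0 := fun j => by
    split_ifs <;> omega
  simp only [h1]
  rw [Finset.sum_add_distrib, Finset.sum_add_distrib, Finset.sum_ite_eq', Finset.sum_ite_eq',
    Finset.sum_const, Finset.card_range]
  simp

/-- `v` has three different neighbours. -/
def HasThreeNeighbours {V : Type*} (G : SimpleGraph V) (v : V) : Prop :=
  ∃ x y z, x ≠ y ∧ x ≠ z ∧ y ≠ z ∧ G.Adj v x ∧ G.Adj v y ∧ G.Adj v z

theorem HasThreeNeighbours.map {V W : Type*} {G : SimpleGraph V} {H : SimpleGraph W}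
    (φ : G ≃g H) {v : V} (h : HasThreeNeighbours G v) : HasThreeNeighbours H (φ v) := by
  obtain ⟨x, y, z, h1, h2, h3, h4, h5, h6⟩ := h
  exact ⟨φ x, φ y, φ z, φ.injective.ne h1, φ.injective.ne h2, φ.injective.ne h3,
    φ.map_adj_iff.2 h4, φ.map_adj_iff.2 h5, φ.map_adj_iff.2 h6⟩

theorem adj_inl_inl {i j : Fin (d + 1)} :
    (pendentPath d a).Adj (.inl i) (.inl j) ↔ i.1 + 1 = j.1 ∨ j.1 + 1 = i.1 :=
  SimpleGraph.pathGraph_adj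

theorem hasThreeNeighbours_inl {i : Fin (d + 1)} (h1 : 1 ≤ i.1) (h2 : i.1 < d)
    (h3 : 0 < a i.1) : HasThreeNeighbours (pendentPath d a) (.inl i) := by
  refine ⟨.inl ⟨i.1 - 1, by omega⟩, .inl ⟨i.1 + 1, by omega⟩, .inr ⟨i, ⟨0, h3⟩⟩, ?_, by simp,
    by simp, adj_inl_inl.2 ?_, adj_inl_inl.2 ?_, rfl⟩
  · simp only [ne_eq, Sum.inl.injEq, Fin.ext_iff]
    omega
  · simp only []
    omega
  · simp

theorem eq_inl_of_hasThreeNeighbours {v : PendentPathVertex d a}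
    (h : HasThreeNeighbours (pendentPath d a) v) : ∃ i, v = .inl i ∧ 0 < a i.1 := by
  obtain ⟨x, y, z, hxy, hxz, hyz, hx, hy, hz⟩ := h
  rcases v with i | p
  · refine ⟨i, rfl, ?_⟩
    have key : ∀ w, (pendentPath d a).Adj (.inl i) w → ¬ 0 < a i.1 →
        ∃ j : Fin (d + 1), w = .inl j ∧ (i.1 + 1 = j.1 ∨ j.1 + 1 = i.1) := by
      rintro (j | q) hw h0
      · exact ⟨j, rfl, adj_inl_inl.1 hw⟩
      · have h1 : q.1 = i := hw
        have h2 : 0 < a q.1.1 := Nat.lt_of_le_of_lt (Nat.zero_le _) q.2.2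
        rw [h1] at h2
        exact absurd h2 h0
    by_contra h0
    obtain ⟨jx, rfl, h1⟩ := key x hx h0
    obtain ⟨jy, rfl, h2⟩ := key y hy h0
    obtain ⟨jz, rfl, h3⟩ := key z hz h0
    simp only [ne_eq, Sum.inl.injEq, Fin.ext_iff] at hxy hxz hyz
    omega
  · have key : ∀ w, (pendentPath d a).Adj (.inr p) w → w = .inl p.1 := by
      rintro (j | q) hw
      · exact congrArg _ (show p.1 = j from hw).symm
      · exact absurd hw id
    exact absurd ((key x hx).trans (key y hy).symm) hxy

/-- The vertex types differ, so the indices are compared through the numerical formula; this avoids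
transport along an isomorphism. -/
theorem steinerWiener_congr {k : ℕ} (hk : 1 ≤ k) {d' : ℕ} {a' : ℕ → ℕ} (hd : d = d')
    (h : ∀ i, a i = a' i) :
    steinerWiener k (pendentPath d a) = steinerWiener k (pendentPath d' a') := by
  subst hd
  have h1 := steinerWiener_add (d := d) (a := a) hk rfl
  have h2 := steinerWiener_add (d := d) (a := a') hk rfl
  simp only [card_vertex, edgeSum, ← h] at h1 h2
  exact Nat.add_right_cancel (h1.trans h2.symm)

end PendentPath

section Threshold

variable {n d k : ℕ}

theorem oneSidedTree_card (hn : d + 3 ≤ n) (hd : 3 ≤ d) :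
    Fintype.card (PendentPathVertex d fun i => if i = (d - 1) / 2 then n - d - 1 else 0) = n := by
  rw [PendentPath.card_vertex, PendentPath.sum_single, if_pos (by omega)]
  omega

theorem twoSidedTree_card (hn : d + 3 ≤ n) (hd : 3 ≤ d) :
    Fintype.card (PendentPathVertex d fun i =>
      if i = (d - 1) / 2 then n - d - 2 else if i = d / 2 + 1 then 1 else 0) = n := by
  rw [PendentPath.card_vertex, PendentPath.sum_double (by omega), if_pos (by omega),
    if_pos (by omega)]
  omega

/-- The positions (d - 1) / 2 and d / 2 + 1 add up to d. Being mirror images, they give their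
pendent vertices the same eccentricity. -/
theorem eccentricSequence_twoSidedTree (hn : d + 3 ≤ n) (hd : 3 ≤ d) :
    eccentricSequence (twoSidedTree n d) = eccentricSequence (oneSidedTree n d) := by
  refine eccentricSequence_eq_of_eccCount fun e => ?_
  rw [PendentPath.eccCount_double (by omega) (by omega) (by omega),
    PendentPath.eccCount_single (by omega) (by omega)]
  congr 1
  have h1 : max ((d - 1) / 2) (d - (d - 1) / 2) = max (d / 2 + 1) (d - (d / 2 + 1)) := by omega
  rw [h1]
  split_ifs <;> omega

/-- Moving a pendent edge changes the cut sizes only at the one or two path edges between the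
attachment vertices. There both parts have at most n - ⌈d/2⌉ < k vertices in either tree, so these
edges contribute zero. -/
theorem steinerWiener_twoSidedTree (hn : d + 3 ≤ n) (hd : 3 ≤ d) (hk : n + 1 - (d + 1) / 2 ≤ k) :
    steinerWiener k (twoSidedTree n d) = steinerWiener k (oneSidedTree n d) := by
  have h1 := PendentPath.steinerWiener_add (k := k) (by omega) (oneSidedTree_card hn hd)
  have h2 := PendentPath.steinerWiener_add (k := k) (by omega) (twoSidedTree_card hn hd)
  have h3 : PendentPath.edgeSum n k d
      (fun i => if i = (d - 1) / 2 then n - d - 2 else if i = d / 2 + 1 then 1 else 0) =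
      PendentPath.edgeSum n k d (fun i => if i = (d - 1) / 2 then n - d - 1 else 0) := by
    simp only [PendentPath.edgeSum, PendentPath.sum_single,
      PendentPath.sum_double (show (d - 1) / 2 < d / 2 + 1 by omega)]
    congr 1
    · refine Finset.sum_congr rfl fun i hi => ?_
      rw [Finset.mem_range] at hi
      by_cases hX : (d - 1) / 2 ≤ i
      · by_cases hY : d / 2 + 1 ≤ i
        · rw [if_pos hX, if_pos hX, if_pos hY]
          congr 1
          omega
        · rw [if_pos hX, if_pos hX, if_neg hY, unsplitCount_eq_zero (by omega) (by omega),
            unsplitCount_eq_zero (by omega) (by omega)]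
      · rw [if_neg hX, if_neg hX, if_neg (by omega)]
    · have h4 := PendentPath.sum_single ((d - 1) / 2) (n - d - 1) d
      have h5 := PendentPath.sum_double (show (d - 1) / 2 < d / 2 + 1 by omega) (n - d - 2) 1 d
      rw [Finset.sum_add_distrib, if_pos (by omega)] at h4 h5
      rw [if_pos (by omega)] at h5
      congr 1
      omega
  rw [h3] at h2
  exact Nat.add_right_cancel (h2.trans h1.symm)

/-- The trees have two and one vertices of degree at least three, respectively. -/
theorem isEmpty_iso_twoSidedTree (hn : d + 3 ≤ n) (hd : 3 ≤ d) :
    IsEmpty (twoSidedTree n d ≃g oneSidedTree n d) := by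
  refine ⟨fun φ => ?_⟩
  have hX : PendentPath.HasThreeNeighbours (twoSidedTree n d)
      (.inl ⟨(d - 1) / 2, by omega⟩) := by
    refine PendentPath.hasThreeNeighbours_inl ?_ ?_ ?_
    · simp only []
      omega
    · simp only []
      omega
    · simp only [if_true]
      omega
  have hY : PendentPath.HasThreeNeighbours (twoSidedTree n d)
      (.inl ⟨d / 2 + 1, by omega⟩) := by
    refine PendentPath.hasThreeNeighbours_inl ?_ ?_ ?_
    · simp only []
      omega
    · simp only []
      omega
    · simp only [if_true]
      split_ifs <;> omega
  have key : ∀ v, PendentPath.HasThreeNeighbours (oneSidedTree n d) v →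
      v = .inl ⟨(d - 1) / 2, by omega⟩ := by
    intro v hv
    obtain ⟨i, rfl, hi⟩ := PendentPath.eq_inl_of_hasThreeNeighbours hv
    congr 1
    ext
    by_contra hne
    rw [if_neg hne] at hi
    omega
  have h1 := φ.injective ((key _ (hX.map φ)).trans (key _ (hY.map φ)).symm)
  simp only [Sum.inl.injEq, Fin.mk.injEq] at h1
  omega

theorem pathLength_oneSidedTree (hd : 3 ≤ d) :
    d = seqRadius (eccentricSequence (oneSidedTree n d)) +
      seqNumValues (eccentricSequence (oneSidedTree n d)) - 1 := by
  classical
  obtain ⟨c, c', par, h⟩ := PendentPath.exists_isCentralRooting (d := d)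
    (a := fun i => if i = (d - 1) / 2 then n - d - 1 else 0) (by omega)
    (if_neg (by omega)) (if_neg (by omega))
  rw [h.pathLength_eq]
  omega

/-- Each level above the radius contains two path vertices. All pendent vertices share one level,
which the standard tree also places at position (d - 1) / 2. -/
theorem standardPendents_oneSidedTree (hd : 3 ≤ d) (i : ℕ) :
    (if i = (d - 1) / 2 then n - d - 1 else 0) =
      standardPendents (seqNumValues (eccentricSequence (oneSidedTree n d)))
        (seqMult (eccentricSequence (oneSidedTree n d))) i := by
  classical
  obtain ⟨c, c', par, h⟩ := PendentPath.exists_isCentralRooting (d := d)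
    (a := fun i => if i = (d - 1) / 2 then n - d - 1 else 0) (by omega)
    (if_neg (by omega)) (if_neg (by omega))
  rcases Nat.eq_zero_or_pos i with rfl | hpos
  · rw [IsCentralRooting.standardPendents_zero, if_neg (by omega)]
  obtain ⟨i, rfl⟩ : ∃ j, i = j + 1 := ⟨i - 1, by omega⟩
  rcases Nat.lt_or_ge i (d / 2) with hlt | hge
  · rw [h.standardPendents_succ hlt, PendentPath.eccCount_single (by omega) (by omega),
      show d / 2 + (d - d / 2) - i = d - i by omega, PendentPath.card_path_vertices (by omega)]
    split_ifs <;> omega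
  · rw [h.standardPendents_of_lt (by omega), if_neg (by omega)]

theorem nonempty_iso_oneSidedTree (hd : 3 ≤ d) :
    Nonempty (oneSidedTree n d ≃g extremalTree (eccentricSequence (oneSidedTree n d))) :=
  PendentPath.congr_iso (pathLength_oneSidedTree hd) fun i _ => standardPendents_oneSidedTree hd i

theorem steinerWiener_oneSidedTree (hd : 3 ≤ d) (hk : 1 ≤ k) :
    steinerWiener k (oneSidedTree n d) =
      steinerWiener k (extremalTree (eccentricSequence (oneSidedTree n d))) :=
  PendentPath.steinerWiener_congr hk (pathLength_oneSidedTree hd)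
    fun i => standardPendents_oneSidedTree hd i

theorem seqDiam_oneSidedTree (hd : 3 ≤ d) :
    seqDiam (eccentricSequence (oneSidedTree n d)) = d := by
  classical
  obtain ⟨c, c', par, h⟩ := PendentPath.exists_isCentralRooting (d := d)
    (a := fun i => if i = (d - 1) / 2 then n - d - 1 else 0) (by omega)
    (if_neg (by omega)) (if_neg (by omega))
  rw [h.seqDiam_eq]
  omega

theorem isTreeEccentricSequence_oneSidedTree (hd : 3 ≤ d) :
    IsTreeEccentricSequence (eccentricSequence (oneSidedTree n d)) := by
  refine isTreeEccentricSequence (PendentPath.isTree _ _) fun v => ?_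
  rw [PendentPath.vertexEcc_eq (a := fun i => if i = (d - 1) / 2 then n - d - 1 else 0)
    (if_neg (by omega)) (if_neg (by omega))]
  omega

end Threshold

theorem theorem3 :
    -- the lower bound, and uniqueness of the extremal tree for `k ≤ n - ⌈d / 2⌉`
    (∀ S : List ℕ, IsTreeEccentricSequence S → 2 < seqOrder S →
      ∀ (V : Type*) [Fintype V] (T : SimpleGraph V), T.IsTree → eccentricSequence T = S →
      ∀ k : ℕ, 2 ≤ k → k ≤ seqOrder S - 1 →
        steinerWiener k (extremalTree S) ≤ steinerWiener k T ∧
        (k ≤ seqOrder S - ⌈(seqDiam S : ℚ) / 2⌉₊ →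
          steinerWiener k T = steinerWiener k (extremalTree S) →
            Nonempty (T ≃g extremalTree S))) ∧
    -- the threshold is best possible
    (∀ n d k : ℕ, d + 3 ≤ n → n + 1 - ⌈(d : ℚ) / 2⌉₊ ≤ k → k ≤ n - 1 →
      ∃ S : List ℕ, IsTreeEccentricSequence S ∧ seqOrder S = n ∧ seqDiam S = d ∧
        (oneSidedTree n d).IsTree ∧ (twoSidedTree n d).IsTree ∧
        eccentricSequence (oneSidedTree n d) = S ∧ eccentricSequence (twoSidedTree n d) = S ∧
        Nonempty (oneSidedTree n d ≃g extremalTree S) ∧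
        steinerWiener k (twoSidedTree n d) = steinerWiener k (extremalTree S) ∧
        IsEmpty (twoSidedTree n d ≃g extremalTree S)) := by
  classical
  refine ⟨?_, ?_⟩
  · rintro S - hn V _ T hT rfl k hk hkn
    rw [seqOrder, length_eccentricSequence] at hn hkn ⊢
    obtain ⟨c, c', x, y, par, D, r, h⟩ := hT.exists_isCentralRooting_of_nontrivial (by omega)
    refine ⟨h.steinerWiener_extremalTree_le (by omega), fun hkd heq => ?_⟩
    have h1 := h.D_le
    have h2 := h.r_le
    rw [Nat.ceil_half, h.seqDiam_eq] at hkd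
    exact h.nonempty_iso_extremalTree hk (by omega) hn heq
  · intro n d k hn hk hkn
    rw [Nat.ceil_half] at hk
    -- The range for k is nonempty only if ⌈d/2⌉ ≥ 2.
    have hd : 3 ≤ d := by omega
    refine ⟨eccentricSequence (oneSidedTree n d), isTreeEccentricSequence_oneSidedTree hd, ?_,
      seqDiam_oneSidedTree hd, PendentPath.isTree _ _, PendentPath.isTree _ _, rfl,
      eccentricSequence_twoSidedTree hn hd, nonempty_iso_oneSidedTree hd, ?_, ⟨fun φ => ?_⟩⟩
    · rw [seqOrder, length_eccentricSequence, oneSidedTree_card hn hd]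
    · rw [steinerWiener_twoSidedTree hn hd hk, steinerWiener_oneSidedTree hd (by omega)]
    · obtain ⟨ψ⟩ := nonempty_iso_oneSidedTree (n := n) hd
      exact (isEmpty_iso_twoSidedTree hn hd).false (φ.trans ψ.symm)
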